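/- Let $n\ge 1$ and $\mu,\mu_c,\kappa>0$, and put $\omega=\mu_c/\mu$. For $M\in\mathbb{R}^{n\times n}$ write $\operatorname{sym}M=\tfrac12(M+M^T)$, $\operatorname{skew}M=\tfrac12(M-M^T)$ and $\operatorname{dev}M=M-\tfrac{\operatorname{tr}M}{n}\mathbb{1}$, let $\langle M,N\rangle=\operatorname{tr}(M^TN)$, and define $$\langle M,N\rangle_{\mu,\mu_c,\kappa}=\mu\,\langle\operatorname{dev}\operatorname{sym}M,\operatorname{dev}\operatorname{sym}N\rangle+\mu_c\,\langle\operatorname{skew}M,\operatorname{skew}N\rangle+\tfrac{\kappa}{n}\operatorname{tr}(M)\operatorname{tr}(N),\qquad \|M\|_{\mu,\mu_c,\kappa}=\sqrt{\langle M,M\rangle_{\mu,\mu_c,\kappa}}.$$ Equip $\mathrm{GL}(n)=\{X\in\mathbb{R}^{n\times n}:\det X\ne0\}$ with the Riemannian metric $g_A(M,N)=\langle A^{-1}M,A^{-1}N\rangle_{\mu,\mu_c,\kappa}$. An admissible curve from $A$ to $B$ is a continuous map $X:[a,b]\to\mathrm{GL}(n)$, $a<b$, with $X(a)=A$ and $X(b)=B$,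 for which there is a partition $a=a_0<\dots<a_{m+1}=b$ such that each restriction $X|_{[a_j,a_{j+1}]}$ is continuously differentiable with nowhere vanishing derivative (one-sided at the endpoints). Its length is $\int_a^b\sqrt{g_{X(t)}(\dot X(t),\dot X(t))}\,dt$, and $\operatorname{dist}_{\mathrm{geod}}(A,B)\in[0,\infty]$ is the infimum of the lengths of all admissible curves from $A$ to $B$. Then for all $A,B\in\mathrm{GL}^+(n)=\{X\in\mathbb{R}^{n\times n}:\det X>0\}$ the set $$\mathcal{M}_{A,B}=\{M\in\mathbb{R}^{n\times n} : A\exp(\operatorname{sym}M-\omega\operatorname{skew}M)\exp((1+\omega)\operatorname{skew}M)=B\}$$ is nonempty, and $$\operatorname{dist}_{\mathrm{geod}}(A,B)=\min\{\|M\|_{\mu,\mu_c,\kappa} : M\in\mathcal{M}_{A,B}\},$$ where the minimum is attained. -/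

import Mathlib

namespace GLGeod

/-- Symmetric part `sym M = (M + Mᵀ) / 2`. -/
noncomputable def symPart {n : ℕ} (M : Matrix (Fin n) (Fin n) ℝ) : Matrix (Fin n) (Fin n) ℝ :=
  (1 / 2 : ℝ) • (M + M.transpose)

/-- Skew-symmetric part `skew M = (M - Mᵀ) / 2`. -/
noncomputable def skewPart {n : ℕ} (M : Matrix (Fin n) (Fin n) ℝ) : Matrix (Fin n) (Fin n) ℝ :=
  (1 / 2 : ℝ) • (M - M.transpose)

/-- Deviatoric (trace-free) part `dev M = M - (tr M / n) • 1`. -/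
noncomputable def devPart {n : ℕ} (M : Matrix (Fin n) (Fin n) ℝ) : Matrix (Fin n) (Fin n) ℝ :=
  M - (M.trace / (n : ℝ)) • (1 : Matrix (Fin n) (Fin n) ℝ)

/-- Canonical inner product `⟨M, N⟩ = tr (Mᵀ N)`. -/
noncomputable def frobInner {n : ℕ} (M N : Matrix (Fin n) (Fin n) ℝ) : ℝ :=
  (M.transpose * N).trace

/-- The isotropic inner product with parameters `μ, μc, κ`:
`μ ⟨dev sym M, dev sym N⟩ + μc ⟨skew M, skew N⟩ + (κ / n) (tr M) (tr N)`. -/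
noncomputable def isoInner {n : ℕ} (μ μc κ : ℝ) (M N : Matrix (Fin n) (Fin n) ℝ) : ℝ :=
  μ * frobInner (devPart (symPart M)) (devPart (symPart N))
    + μc * frobInner (skewPart M) (skewPart N)
    + κ / (n : ℝ) * (M.trace * N.trace)

/-- The norm induced by the isotropic inner product. -/
noncomputable def isoNorm {n : ℕ} (μ μc κ : ℝ) (M : Matrix (Fin n) (Fin n) ℝ) : ℝ :=
  Real.sqrt (isoInner μ μc κ M M)

/-- The left-`GL(n)`-invariant, right-`O(n)`-invariant Riemannian metric on `GL(n)`:
`g_A(M, N) = ⟨A⁻¹ M, A⁻¹ N⟩_{μ,μc,κ}` for `A ∈ GL(n)` and tangent vectors `M, N`. -/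
noncomputable def isoMetric {n : ℕ} (μ μc κ : ℝ) (A M N : Matrix (Fin n) (Fin n) ℝ) : ℝ :=
  isoInner μ μc κ (A⁻¹ * M) (A⁻¹ * N)

/-- `X` restricted to `[c, d]` is a regular continuously differentiable curve: it has a
derivative (one-sided at the endpoints) which is continuous and nowhere zero on `[c, d]`. -/
def IsRegularC1On {n : ℕ} (X : ℝ → Matrix (Fin n) (Fin n) ℝ) (c d : ℝ) : Prop :=
  ∃ X' : ℝ → Matrix (Fin n) (Fin n) ℝ,
    (∀ t ∈ Set.Icc c d, HasDerivWithinAt X (X' t) (Set.Icc c d) t) ∧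
    ContinuousOn X' (Set.Icc c d) ∧
    ∀ t ∈ Set.Icc c d, X' t ≠ 0

/-- `X : [a, b] → GL(n)` is an admissible curve from `A` to `B`: it is continuous, takes
invertible values, joins `A` to `B`, and is regular and continuously differentiable on each
closed piece of some partition `a = p 0 < p 1 < ⋯ < p (m + 1) = b`.
Only the values of `X` on `[a, b]` matter. -/
structure IsAdmissible {n : ℕ} (A B : Matrix (Fin n) (Fin n) ℝ)
    (a b : ℝ) (X : ℝ → Matrix (Fin n) (Fin n) ℝ) : Prop where
  continuousOn : ContinuousOn X (Set.Icc a b)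
  det_ne_zero : ∀ t ∈ Set.Icc a b, (X t).det ≠ 0
  source : X a = A
  target : X b = B
  piecewise : ∃ (m : ℕ) (p : ℕ → ℝ), p 0 = a ∧ p (m + 1) = b ∧
    ∀ j ≤ m, p j < p (j + 1) ∧ IsRegularC1On X (p j) (p (j + 1))

/-- Length of a piecewise continuously differentiable curve on `[a, b]` with respect to the
metric `g`. The derivative exists at every point of `(a, b)` outside the finitely many
breakpoints of the curve, which do not affect the integral. -/
noncomputable def curveLength {n : ℕ}
    (g : Matrix (Fin n) (Fin n) ℝ → Matrix (Fin n) (Fin n) ℝ → Matrix (Fin n) (Fin n) ℝ → ℝ)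
    (a b : ℝ) (X : ℝ → Matrix (Fin n) (Fin n) ℝ) : ℝ :=
  ∫ t in a..b, Real.sqrt (g (X t) (deriv X t) (deriv X t))

/-- Geodesic distance on `GL(n)` with respect to the metric `g`: the infimum in `[0, ∞]` of the
lengths of all admissible curves from `A` to `B` (it is `∞` if there is no such curve). -/
noncomputable def geodDist {n : ℕ}
    (g : Matrix (Fin n) (Fin n) ℝ → Matrix (Fin n) (Fin n) ℝ → Matrix (Fin n) (Fin n) ℝ → ℝ)
    (A B : Matrix (Fin n) (Fin n) ℝ) : ENNReal :=
  sInf {ℓ : ENNReal | ∃ (a b : ℝ) (X : ℝ → Matrix (Fin n) (Fin n) ℝ),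
    IsAdmissible A B a b X ∧ ℓ = ENNReal.ofReal (curveLength g a b X)}

/-- The matrices `M` with `A exp(sym M - ω skew M) exp((1 + ω) skew M) = B`. -/
def geodSolutions {n : ℕ} (ω : ℝ) (A B : Matrix (Fin n) (Fin n) ℝ) :
    Set (Matrix (Fin n) (Fin n) ℝ) :=
  {M | A * NormedSpace.exp (symPart M - ω • skewPart M)
        * NormedSpace.exp ((1 + ω) • skewPart M) = B}

end GLGeod

namespace GLGeod

open scoped Matrix Matrix.Norms.Frobenius

/-! The upper bound is a computation. Put `Z = (1 + ω) skew M` and `Y = sym M - ω skew M`, so that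
`Y + Z = M`. Along `X(t) = A exp(tY) exp(tZ)` the velocity `X⁻¹X'` equals `exp(-tZ) M exp(tZ)`. This
is an orthogonal conjugate of `M`, so the speed is constantly `‖M‖` by isotropy of the norm
(`geodDist_le_isoNorm`).

For the lower bound, minimisers are built by discretisation, without Hopf–Rinow or ODE theory
(`exists_solution_le_length`). A chain is a product `A (1 + g₀) ⋯ (1 + g_{N-1}) = B` with energy `∑
‖gᵢ‖²`. A curve of length `L` yields a chain with `N · energy ≤ (L / (1 - cL/N))²`, and compactness
gives a chain of least energy for each large `N`. Minimality gives a discrete Euler–Lagrange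
equation, and with it a conserved momentum, which forces all steps to have size `O(1/N)`
(`exists_step_bound`).

The scaled steps `Vᵢ = N gᵢ` then follow `V' = (1 + ω)[V, skew V]` up to `O(1/N²)` per step. A
commutator of a symmetric and a skew matrix is symmetric, so the spin `skew V` is almost constant.
In the frame rotating with `Z = (1 + ω) skew V₀` the velocity is almost `V₀`
(`isBigO_rotated_velocity`), and the positions follow the explicit curve with `M = V₀` within
`O(1/N)` (`isBigO_position`).

A limit point `M` of the initial velocities `V₀` therefore solves the endpoint equation. For any
competitor of length `L`, some step satisfies `N ‖gᵢ‖ ≤ L / (1 - cL/N)`. Since rotation preserves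
the norm, `‖V₀‖` exceeds this by at most `O(1/N)`, and the limit gives `‖M‖ ≤ L`. -/

/-- Real square matrices of size `n`. -/
abbrev Mat (n : ℕ) := Matrix (Fin n) (Fin n) ℝ

/-- The topology of the Frobenius norm. It unfolds to the product topology, but instance search
needs it in this form to find the normed structure. -/
@[reducible] noncomputable def frobTopology {n : ℕ} : TopologicalSpace (Mat n) :=
  (Matrix.frobeniusNormedRing (m := Fin n) (α := ℝ)).toMetricSpace.toPseudoMetricSpace.toUniformSpace.toTopologicalSpace

attribute [local instance] frobTopology

variable {n : ℕ}

/-! ### The isotropic inner product and its inertia operator. -/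

section IsoOp

lemma frobInner_eq_sum (M N : Mat n) : frobInner M N = ∑ i, ∑ j, M i j * N i j := by
  simp only [frobInner, Matrix.trace, Matrix.diag, Matrix.mul_apply, Matrix.transpose_apply]
  exact Finset.sum_comm

lemma frobInner_self (M : Mat n) : frobInner M M = ‖M‖ ^ 2 := by
  have h : 0 ≤ ∑ i, ∑ j, M i j * M i j :=
    Finset.sum_nonneg fun i _ => Finset.sum_nonneg fun j _ => mul_self_nonneg _
  rw [frobInner_eq_sum, Matrix.frobenius_norm_def]
  simp only [Real.norm_eq_abs, Real.rpow_two, sq_abs]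
  rw [← Real.sqrt_eq_rpow, Real.sq_sqrt]
  · simp [sq]
  · simpa [sq] using h

lemma frobInner_comm (M N : Mat n) : frobInner M N = frobInner N M := by
  simp only [frobInner_eq_sum, mul_comm]

lemma frobInner_mul_left (M N P : Mat n) : frobInner M (N * P) = frobInner (Nᵀ * M) P := by
  simp [frobInner, Matrix.mul_assoc]

lemma frobInner_mul_right (M N P : Mat n) : frobInner M (N * P) = frobInner (M * Pᵀ) N := by
  simp only [frobInner, Matrix.transpose_mul, Matrix.transpose_transpose]
  rw [← Matrix.mul_assoc, Matrix.trace_mul_comm, Matrix.mul_assoc]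

lemma frobInner_sub_left (M N P : Mat n) :
    frobInner (M - N) P = frobInner M P - frobInner N P := by
  simp [frobInner, Matrix.sub_mul]

lemma eq_of_frobInner_eq {M N : Mat n} (h : ∀ P, frobInner M P = frobInner N P) : M = N := by
  have h1 : frobInner (M - N) (M - N) = 0 := by rw [frobInner_sub_left, h, sub_self]
  rw [frobInner_self] at h1
  exact sub_eq_zero.1 (norm_eq_zero.1 (pow_eq_zero_iff two_ne_zero |>.1 h1))

/-- The operator acting as `a`, `b` and `c` on the trace-free symmetric, the skew-symmetric and the
spherical part respectively. -/
noncomputable def isoOp (a b c : ℝ) : Mat n →L[ℝ] Mat n :=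
  LinearMap.toContinuousLinearMap
    { toFun := fun M => a • devPart (symPart M) + b • skewPart M
        + (c * (M.trace / n)) • (1 : Mat n)
      map_add' := fun M N => by
        ext i j
        simp [devPart, symPart, skewPart]
        ring
      map_smul' := fun r M => by
        ext i j
        simp [devPart, symPart, skewPart]
        ring }

lemma isoOp_apply (a b c : ℝ) (M : Mat n) :
    isoOp a b c M = a • devPart (symPart M) + b • skewPart M
        + (c * (M.trace / n)) • (1 : Mat n) := rfl

lemma trace_symPart (M : Mat n) : (symPart M).trace = M.trace := by
  simp [symPart]; ring

lemma trace_skewPart (M : Mat n) : (skewPart M).trace = 0 := by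
  simp [skewPart]

lemma symPart_add_skewPart (M : Mat n) : symPart M + skewPart M = M := by
  ext i j; simp [symPart, skewPart]; ring

lemma transpose_skewPart (M : Mat n) : (skewPart M)ᵀ = -skewPart M := by
  ext i j; simp [skewPart]; ring

lemma transpose_symPart (M : Mat n) : (symPart M)ᵀ = symPart M := by
  ext i j; simp [symPart]; ring

lemma isoOp_eq (a b c : ℝ) (M : Mat n) :
    isoOp a b c M = a • symPart M + b • skewPart M
      + ((c - a) * (M.trace / n)) • (1 : Mat n) := by
  rw [isoOp_apply, devPart, trace_symPart]
  module

lemma isoOp_one (M : Mat n) : isoOp 1 1 1 M = M := by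
  simp [isoOp_eq, symPart_add_skewPart]

lemma isoOp_isoOp [NeZero n] (a b c a' b' c' : ℝ) (M : Mat n) :
    isoOp a b c (isoOp a' b' c' M) = isoOp (a * a') (b * b') (c * c') M := by
  have hn : (n : ℝ) ≠ 0 := NeZero.ne _
  have htr : (isoOp a' b' c' M).trace = c' * M.trace := by
    rw [isoOp_eq]
    simp only [Matrix.trace_add, Matrix.trace_smul, trace_symPart, trace_skewPart,
      Matrix.trace_one, Fintype.card_fin, smul_eq_mul]
    field_simp
    ring
  rw [isoOp_eq a b c, htr, isoOp_eq a' b' c', isoOp_eq]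
  ext i j
  rcases eq_or_ne i j with rfl | hij
  · simp [symPart, skewPart]
    ring
  · simp [symPart, skewPart, hij]
    ring

/-- Symmetric and skew parts are Frobenius-orthogonal, and removing traces subtracts exactly `tr M
tr N / n`. With the metric written through an operator, stationarity conditions become matrix
equations. -/
lemma isoInner_eq_frobInner [NeZero n] (a b c : ℝ) (M N : Mat n) :
    isoInner a b c M N = frobInner (isoOp a b c M) N := by
  have hn : (n : ℝ) ≠ 0 := NeZero.ne _
  have h1 : ∀ P Q : Mat n, frobInner (symPart P) (skewPart Q) = 0 := by
    intro P Q
    have : frobInner (symPart P) (skewPart Q) = - frobInner (symPart P) (skewPart Q) := by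
      conv_lhs => rw [frobInner, ← Matrix.trace_transpose, Matrix.transpose_mul,
        Matrix.transpose_transpose, transpose_skewPart, Matrix.trace_mul_comm]
      rw [frobInner, transpose_symPart]
      simp
    linarith
  have h2 : frobInner (symPart M) N = frobInner (symPart M) (symPart N) := by
    conv_lhs => rw [← symPart_add_skewPart N]
    rw [frobInner_comm, frobInner, Matrix.transpose_add, Matrix.add_mul, Matrix.trace_add]
    change frobInner _ _ + frobInner _ _ = _
    rw [frobInner_comm (skewPart N), h1, add_zero, frobInner_comm]
  have h3 : frobInner (skewPart M) N = frobInner (skewPart M) (skewPart N) := by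
    conv_lhs => rw [← symPart_add_skewPart N]
    rw [frobInner_comm, frobInner, Matrix.transpose_add, Matrix.add_mul, Matrix.trace_add]
    change frobInner _ _ + frobInner _ _ = _
    rw [h1, zero_add, frobInner_comm]
  have h4 : frobInner (devPart (symPart M)) (devPart (symPart N))
      = frobInner (symPart M) (symPart N) - M.trace * N.trace / n := by
    simp only [frobInner, devPart, trace_symPart, Matrix.transpose_sub, Matrix.transpose_smul,
      Matrix.transpose_one, transpose_symPart, Matrix.sub_mul, Matrix.mul_sub, Matrix.trace_sub,
      Matrix.smul_mul, Matrix.mul_smul, Matrix.one_mul, Matrix.mul_one, Matrix.trace_smul,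
      Matrix.trace_one, Fintype.card_fin, smul_eq_mul]
    field_simp
    ring
  have h5 : frobInner (isoOp a b c M) N = a * frobInner (symPart M) N + b * frobInner (skewPart M) N
      + (c - a) * (M.trace / n) * N.trace := by
    rw [isoOp_eq]
    simp only [frobInner, Matrix.transpose_add, Matrix.transpose_smul, Matrix.add_mul,
      Matrix.smul_mul, Matrix.trace_add, Matrix.trace_smul, Matrix.transpose_one, Matrix.one_mul,
      smul_eq_mul]
  rw [h5, h2, h3, isoInner, h4]
  field_simp
  ring

lemma isoInner_comm (a b c : ℝ) (M N : Mat n) : isoInner a b c M N = isoInner a b c N M := by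
  rw [isoInner, isoInner, frobInner_comm, frobInner_comm (skewPart M), mul_comm M.trace]

variable {μ μc κ : ℝ}

/-- The operator with square-rooted coefficients is a self-adjoint square root of `isoOp μ μc κ`.
The isotropic norm is thus the Frobenius norm of a linear image, and inherits the triangle
inequality, continuity and equivalence of norms. -/
lemma isoInner_self [NeZero n] (hμ : 0 < μ) (hμc : 0 < μc) (hκ : 0 < κ) (M : Mat n) :
    isoInner μ μc κ M M = ‖isoOp √μ √μc √κ M‖ ^ 2 := by
  rw [← frobInner_self, ← isoInner_eq_frobInner √μ √μc √κ M, isoInner_comm √μ √μc √κ,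
    isoInner_eq_frobInner √μ √μc √κ, isoOp_isoOp, Real.mul_self_sqrt hμ.le,
    Real.mul_self_sqrt hμc.le, Real.mul_self_sqrt hκ.le, isoInner_eq_frobInner]

lemma isoNorm_eq [NeZero n] (hμ : 0 < μ) (hμc : 0 < μc) (hκ : 0 < κ) (M : Mat n) :
    isoNorm μ μc κ M = ‖isoOp √μ √μc √κ M‖ := by
  rw [isoNorm, isoInner_self hμ hμc hκ, Real.sqrt_sq (norm_nonneg _)]

lemma sq_isoNorm [NeZero n] (hμ : 0 < μ) (hμc : 0 < μc) (hκ : 0 < κ) (M : Mat n) :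
    isoNorm μ μc κ M ^ 2 = isoInner μ μc κ M M := by
  rw [isoNorm_eq hμ hμc hκ, isoInner_self hμ hμc hκ]

lemma isoNorm_nonneg (M : Mat n) : 0 ≤ isoNorm μ μc κ M := Real.sqrt_nonneg _

lemma isoOp_left_inv [NeZero n] {a b c : ℝ} (ha : a ≠ 0) (hb : b ≠ 0) (hc : c ≠ 0) (M : Mat n) :
    isoOp a⁻¹ b⁻¹ c⁻¹ (isoOp a b c M) = M := by
  rw [isoOp_isoOp, inv_mul_cancel₀ ha, inv_mul_cancel₀ hb, inv_mul_cancel₀ hc, isoOp_one]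

lemma exists_norm_le_isoNorm [NeZero n] (hμ : 0 < μ) (hμc : 0 < μc) (hκ : 0 < κ) :
    ∃ K, 0 < K ∧ ∀ M : Mat n, ‖M‖ ≤ K * isoNorm μ μc κ M := by
  obtain ⟨K, hK, h⟩ := (isoOp (n := n) (√μ)⁻¹ (√μc)⁻¹ (√κ)⁻¹).bound
  refine ⟨K, hK, fun M => ?_⟩
  rw [isoNorm_eq hμ hμc hκ]
  conv_lhs => rw [← isoOp_left_inv (Real.sqrt_pos.2 hμ).ne' (Real.sqrt_pos.2 hμc).ne'
    (Real.sqrt_pos.2 hκ).ne' M]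
  exact h _

lemma exists_isoNorm_le_norm [NeZero n] (hμ : 0 < μ) (hμc : 0 < μc) (hκ : 0 < κ) :
    ∃ K, 0 < K ∧ ∀ M : Mat n, isoNorm μ μc κ M ≤ K * ‖M‖ := by
  obtain ⟨K, hK, h⟩ := (isoOp (n := n) √μ √μc √κ).bound
  exact ⟨K, hK, fun M => (isoNorm_eq hμ hμc hκ M).le.trans (h M)⟩

lemma continuous_isoNorm [NeZero n] (hμ : 0 < μ) (hμc : 0 < μc) (hκ : 0 < κ) :
    Continuous (isoNorm μ μc κ : Mat n → ℝ) := by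
  rw [funext (isoNorm_eq hμ hμc hκ)]
  fun_prop

lemma isoNorm_add_le [NeZero n] (hμ : 0 < μ) (hμc : 0 < μc) (hκ : 0 < κ) (M N : Mat n) :
    isoNorm μ μc κ (M + N) ≤ isoNorm μ μc κ M + isoNorm μ μc κ N := by
  simp only [isoNorm_eq hμ hμc hκ, map_add]
  exact norm_add_le _ _

lemma exists_isoNorm_mul_le [NeZero n] (hμ : 0 < μ) (hμc : 0 < μc) (hκ : 0 < κ) :
    ∃ K, 0 < K ∧ ∀ M N : Mat n,
      isoNorm μ μc κ (M * N) ≤ K * isoNorm μ μc κ M * isoNorm μ μc κ N := by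
  obtain ⟨K, hK, h⟩ := exists_norm_le_isoNorm (n := n) hμ hμc hκ
  obtain ⟨K', hK', h'⟩ := exists_isoNorm_le_norm (n := n) hμ hμc hκ
  refine ⟨K' * K * K, by positivity, fun M N => ?_⟩
  calc isoNorm μ μc κ (M * N) ≤ K' * ‖M * N‖ := h' _
    _ ≤ K' * (‖M‖ * ‖N‖) := by gcongr; exact norm_mul_le _ _
    _ ≤ K' * ((K * isoNorm μ μc κ M) * (K * isoNorm μ μc κ N)) := by
      gcongr
      · exact mul_nonneg hK.le (isoNorm_nonneg _)
      · exact h _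
      · exact h _
    _ = _ := by ring

lemma isoNorm_eq_zero [NeZero n] (hμ : 0 < μ) (hμc : 0 < μc) (hκ : 0 < κ) {M : Mat n}
    (h : isoNorm μ μc κ M ≤ 0) : M = 0 := by
  obtain ⟨K, hK, hM⟩ := exists_norm_le_isoNorm (n := n) hμ hμc hκ
  refine norm_le_zero_iff.1 ((hM M).trans ?_)
  exact mul_nonpos_of_nonneg_of_nonpos hK.le h

/-- Orthogonal conjugation commutes with `sym`, `skew` and `dev` and preserves trace and Frobenius
product. -/
lemma isoInner_conj {Q : Mat n} (hQ : Q * Qᵀ = 1) (M : Mat n) :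
    isoInner μ μc κ (Qᵀ * M * Q) (Qᵀ * M * Q) = isoInner μ μc κ M M := by
  have htr : ∀ P : Mat n, (Qᵀ * P * Q).trace = P.trace := fun P => by
    rw [Matrix.trace_mul_comm, ← Matrix.mul_assoc, hQ, Matrix.one_mul]
  have hQ' : Qᵀ * Q = 1 := mul_eq_one_comm.1 hQ
  have hfrob : ∀ P R : Mat n, frobInner (Qᵀ * P * Q) (Qᵀ * R * Q) = frobInner P R := fun P R => by
    rw [frobInner, Matrix.transpose_mul, Matrix.transpose_mul, Matrix.transpose_transpose]
    have : Qᵀ * (Pᵀ * Q) * (Qᵀ * R * Q) = Qᵀ * (Pᵀ * (Q * Qᵀ) * R) * Q := by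
      simp only [Matrix.mul_assoc]
    rw [this, htr, hQ, Matrix.mul_one, frobInner]
  have hsym : symPart (Qᵀ * M * Q) = Qᵀ * symPart M * Q := by
    simp [symPart, Matrix.mul_add, Matrix.add_mul, Matrix.mul_assoc]
  have hskew : skewPart (Qᵀ * M * Q) = Qᵀ * skewPart M * Q := by
    simp [skewPart, Matrix.mul_sub, Matrix.sub_mul, Matrix.mul_assoc]
  have hdev : devPart (Qᵀ * symPart M * Q) = Qᵀ * devPart (symPart M) * Q := by
    simp [devPart, Matrix.mul_sub, Matrix.sub_mul, htr, hQ']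
  rw [isoInner, isoInner, hsym, hdev, hskew, hfrob, hfrob, htr]

lemma isoNorm_conj {Q : Mat n} (hQ : Q * Qᵀ = 1) (M : Mat n) :
    isoNorm μ μc κ (Qᵀ * M * Q) = isoNorm μ μc κ M := by
  rw [isoNorm, isoInner_conj hQ, isoNorm]

end IsoOp

end GLGeod

namespace GLGeod

open scoped Matrix Matrix.Norms.Frobenius

variable {n : ℕ} {μ μc κ : ℝ}

/-! ### The explicit curves and their length. -/

section ExplicitCurve

lemma transpose_exp_smul_skewPart (t : ℝ) (M : Mat n) :
    (NormedSpace.exp (t • skewPart M))ᵀ = NormedSpace.exp (-(t • skewPart M)) := by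
  rw [← Matrix.exp_transpose, Matrix.transpose_smul, transpose_skewPart, smul_neg]

lemma exp_mul_exp_neg (M : Mat n) : NormedSpace.exp M * NormedSpace.exp (-M) = 1 := by
  rw [← Matrix.exp_add_of_commute _ _ (Commute.refl M).neg_right, add_neg_cancel,
    NormedSpace.exp_zero]

lemma exp_neg_mul_exp (M : Mat n) : NormedSpace.exp (-M) * NormedSpace.exp M = 1 := by
  simpa using exp_mul_exp_neg (-M)

lemma exp_smul_skewPart_mul_transpose (t : ℝ) (M : Mat n) :
    NormedSpace.exp (t • skewPart M) * (NormedSpace.exp (t • skewPart M))ᵀ = 1 := by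
  rw [transpose_exp_smul_skewPart, exp_mul_exp_neg]

lemma det_exp_ne_zero (M : Mat n) : (NormedSpace.exp M).det ≠ 0 :=
  ((Matrix.isUnit_iff_isUnit_det _).1 (Matrix.isUnit_exp M)).ne_zero

/-- The curve `t ↦ A exp (t (sym M - ω skew M)) exp (t (1 + ω) skew M)`. -/
noncomputable def geodCurve (ω : ℝ) (A M : Mat n) (t : ℝ) : Mat n :=
  A * NormedSpace.exp (t • (symPart M - ω • skewPart M))
    * NormedSpace.exp ((t * (1 + ω)) • skewPart M)

lemma det_geodCurve_ne_zero {ω : ℝ} {A : Mat n} (hA : A.det ≠ 0) (M : Mat n) (t : ℝ) :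
    (geodCurve ω A M t).det ≠ 0 := by
  rw [geodCurve, Matrix.det_mul, Matrix.det_mul]
  exact mul_ne_zero (mul_ne_zero hA (det_exp_ne_zero _)) (det_exp_ne_zero _)

lemma hasDerivAt_geodCurve (ω : ℝ) (A M : Mat n) (t : ℝ) :
    HasDerivAt (geodCurve ω A M)
      (geodCurve ω A M t * ((NormedSpace.exp ((t * (1 + ω)) • skewPart M))ᵀ * M
        * NormedSpace.exp ((t * (1 + ω)) • skewPart M))) t := by
  set Y := symPart M - ω • skewPart M with hY
  set Z := (1 + ω) • skewPart M with hZ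
  have hMYZ : M = Y + Z := by
    conv_lhs => rw [← symPart_add_skewPart M]
    rw [hY, hZ]
    module
  have hZt : (t * (1 + ω)) • skewPart M = t • Z := by rw [hZ, smul_smul]
  have h1 : HasDerivAt (fun u : ℝ => NormedSpace.exp (u • Y)) (NormedSpace.exp (t • Y) * Y) t :=
    hasDerivAt_exp_smul_const Y t
  have h2 : HasDerivAt (fun u : ℝ => NormedSpace.exp (u • Z)) (Z * NormedSpace.exp (t • Z)) t :=
    hasDerivAt_exp_smul_const' Z t
  have h3 := (h1.const_mul A).mul h2
  have hfun : geodCurve ω A M = fun u : ℝ =>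
      A * NormedSpace.exp (u • Y) * NormedSpace.exp (u • Z) := by
    funext u
    rw [geodCurve, hZ, smul_smul]
  rw [transpose_exp_smul_skewPart, hZt, hfun]
  refine h3.congr_deriv ?_
  -- Inserting `exp(tZ) exp(-tZ) = 1` before `Y + Z = M` pulls the curve itself out on the left.
  have h4 := exp_mul_exp_neg (t • Z)
  conv_rhs => rw [hMYZ]
  calc _ = A * NormedSpace.exp (t • Y) * (1 : Mat n) * (Y + Z) * NormedSpace.exp (t • Z) := by
        noncomm_ring
    _ = _ := by rw [← h4]; noncomm_ring

lemma inv_mul_mul_cancel {X : Mat n} (hX : X.det ≠ 0) (M : Mat n) : X⁻¹ * (X * M) = M :=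
  Matrix.nonsing_inv_mul_cancel_left _ _ (isUnit_iff_ne_zero.2 hX)

lemma isAdmissible_geodCurve {ω : ℝ} {A B M : Mat n} (hA : A.det ≠ 0) (hM : M ≠ 0)
    (h : M ∈ geodSolutions ω A B) : IsAdmissible A B 0 1 (geodCurve ω A M) where
  continuousOn t _ := (hasDerivAt_geodCurve ω A M t).continuousAt.continuousWithinAt
  det_ne_zero t _ := det_geodCurve_ne_zero hA M t
  source := by simp [geodCurve]
  target := by simpa [geodCurve, geodSolutions] using h
  piecewise := by
    refine ⟨0, fun j => j, by simp, by simp, fun j hj => ?_⟩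
    obtain rfl : j = 0 := by omega
    refine ⟨by simp, fun t => geodCurve ω A M t *
      ((NormedSpace.exp ((t * (1 + ω)) • skewPart M))ᵀ * M
        * NormedSpace.exp ((t * (1 + ω)) • skewPart M)), fun t _ =>
        (hasDerivAt_geodCurve ω A M t).hasDerivWithinAt, ?_, fun t _ h0 => hM ?_⟩
    · have h1 : Continuous (geodCurve ω A M) :=
        continuous_iff_continuousAt.2 fun t => (hasDerivAt_geodCurve ω A M t).continuousAt
      have h2 : Continuous fun t : ℝ => NormedSpace.exp ((t * (1 + ω)) • skewPart M) := by
        refine (NormedSpace.exp_continuous (𝔸 := Mat n)).comp ?_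
        fun_prop
      have h3 : Continuous fun t : ℝ => (NormedSpace.exp ((t * (1 + ω)) • skewPart M))ᵀ :=
        h2.matrix_transpose
      exact (h1.mul ((h3.mul continuous_const).mul h2)).continuousOn
    · set Q := NormedSpace.exp ((t * (1 + ω)) • skewPart M)
      have hQ : Q * Qᵀ = 1 := exp_smul_skewPart_mul_transpose _ _
      have h1 : Qᵀ * M * Q = 0 := by
        have h2 : geodCurve ω A M t * (Qᵀ * M * Q) = 0 := h0
        rw [← inv_mul_mul_cancel (det_geodCurve_ne_zero (ω := ω) hA M t) (Qᵀ * M * Q), h2,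
          mul_zero]
      calc M = (Q * Qᵀ) * M * (Q * Qᵀ) := by rw [hQ, one_mul, mul_one]
        _ = Q * (Qᵀ * M * Q) * Qᵀ := by noncomm_ring
        _ = 0 := by rw [h1, mul_zero, zero_mul]

lemma curveLength_geodCurve {ω : ℝ} {A : Mat n} (hA : A.det ≠ 0) (M : Mat n) :
    curveLength (isoMetric μ μc κ) 0 1 (geodCurve ω A M) = isoNorm μ μc κ M := by
  have h : ∀ t : ℝ, Real.sqrt (isoMetric μ μc κ (geodCurve ω A M t) (deriv (geodCurve ω A M) t)
      (deriv (geodCurve ω A M) t)) = isoNorm μ μc κ M := fun t => by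
    have hd : deriv (geodCurve ω A M) t = _ := (hasDerivAt_geodCurve ω A M t).deriv
    rw [hd, isoMetric,
      inv_mul_mul_cancel (det_geodCurve_ne_zero hA M t),
      isoInner_conj (exp_smul_skewPart_mul_transpose _ _), isoNorm]
  simp only [curveLength, h]
  simp

end ExplicitCurve

/-! ### Short loops, for coinciding end points. -/

section Loop

/-- The curve running along the ray `e ^ s A`, `0 ≤ s ≤ ε`, and back, for `0 ≤ t ≤ 2`. -/
noncomputable def rayLoop (ε : ℝ) (A : Mat n) (t : ℝ) : Mat n :=
  Real.exp (ε * (1 - |t - 1|)) • A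

lemma det_rayLoop_ne_zero {ε : ℝ} {A : Mat n} (hA : A.det ≠ 0) (t : ℝ) :
    (rayLoop ε A t).det ≠ 0 := by
  rw [rayLoop, Matrix.det_smul]
  exact mul_ne_zero (pow_ne_zero _ (Real.exp_ne_zero _)) hA

lemma hasDerivAt_exp_affine_smul (a b : ℝ) (A : Mat n) (t : ℝ) :
    HasDerivAt (fun s : ℝ => Real.exp (a * s + b) • A) (a • Real.exp (a * t + b) • A) t := by
  have h1 : HasDerivAt (fun s : ℝ => a * s + b) a t := by
    simpa using ((hasDerivAt_id t).const_mul a).add_const b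
  have h2 := h1.exp.smul_const A
  rw [mul_comm, mul_smul] at h2
  exact h2

lemma rayLoop_of_le {ε t : ℝ} (ht : t ≤ 1) (A : Mat n) :
    rayLoop ε A t = Real.exp (ε * t + 0) • A := by
  rw [rayLoop, abs_of_nonpos (by linarith)]
  ring_nf

lemma rayLoop_of_ge {ε t : ℝ} (ht : 1 ≤ t) (A : Mat n) :
    rayLoop ε A t = Real.exp (-ε * t + 2 * ε) • A := by
  rw [rayLoop, abs_of_nonneg (by linarith)]
  ring_nf

lemma isRegularC1On_of_eq_exp_smul {X : ℝ → Mat n} {a b c d : ℝ} (ha : a ≠ 0) {A : Mat n}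
    (hA : A ≠ 0) (h : ∀ t ∈ Set.Icc c d, X t = Real.exp (a * t + b) • A) :
    IsRegularC1On X c d := by
  refine ⟨fun t => a • Real.exp (a * t + b) • A, fun t ht => ?_, ?_, fun t _ => ?_⟩
  · exact (hasDerivAt_exp_affine_smul a b A t).hasDerivWithinAt.congr h (h t ht)
  · have : Continuous fun t : ℝ => a • Real.exp (a * t + b) • A := by fun_prop
    exact this.continuousOn
  · exact smul_ne_zero ha (smul_ne_zero (Real.exp_ne_zero _) hA)

lemma isAdmissible_rayLoop [NeZero n] {ε : ℝ} (hε : 0 < ε) {A : Mat n} (hA : A.det ≠ 0) :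
    IsAdmissible A A 0 2 (rayLoop ε A) where
  continuousOn := by
    have : Continuous (rayLoop ε A) := by unfold rayLoop; fun_prop
    exact this.continuousOn
  det_ne_zero t _ := det_rayLoop_ne_zero hA t
  source := by simp [rayLoop]
  target := by norm_num [rayLoop]
  piecewise := by
    have hA0 : A ≠ 0 := fun h => hA (by rw [h, Matrix.det_zero])
    refine ⟨1, fun j => j, by simp, by norm_num, fun j hj => ⟨by simp, ?_⟩⟩
    obtain rfl | rfl : j = 0 ∨ j = 1 := by omega
    · refine isRegularC1On_of_eq_exp_smul hε.ne' hA0 fun t ht => rayLoop_of_le ?_ A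
      simpa using ht.2
    · refine isRegularC1On_of_eq_exp_smul (neg_ne_zero.2 hε.ne') hA0
        fun t ht => rayLoop_of_ge ?_ A
      simpa using ht.1

lemma isoInner_smul_one [NeZero n] (a : ℝ) :
    isoInner μ μc κ (a • (1 : Mat n)) (a • (1 : Mat n)) = a ^ 2 * (κ * n) := by
  have hn : (n : ℝ) ≠ 0 := NeZero.ne _
  have h1 : symPart (a • (1 : Mat n)) = a • 1 := by
    rw [symPart, Matrix.transpose_smul, Matrix.transpose_one]; module
  have h2 : skewPart (a • (1 : Mat n)) = 0 := by
    rw [skewPart, Matrix.transpose_smul, Matrix.transpose_one]; module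
  have h3 : devPart (a • (1 : Mat n)) = 0 := by
    rw [devPart]
    simp [hn]
  simp only [isoInner, h1, h2, h3]
  simp [frobInner]
  field_simp

/-- On each leg the left-invariant velocity is `±ε • 1`, of norm `ε √(κ n)`. The corner `t = 1` is a
null set. -/
lemma curveLength_rayLoop [NeZero n] {ε : ℝ} (hε : 0 < ε) {A : Mat n} (hA : A.det ≠ 0) :
    curveLength (isoMetric μ μc κ) 0 2 (rayLoop ε A) = 2 * (ε * √(κ * n)) := by
  have h : ∀ t : ℝ, t ≠ 1 → Real.sqrt (isoMetric μ μc κ (rayLoop ε A t) (deriv (rayLoop ε A) t)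
      (deriv (rayLoop ε A) t)) = ε * √(κ * n) := fun t ht => by
    obtain ⟨a, ha, hd⟩ : ∃ a : ℝ, a ^ 2 = ε ^ 2 ∧
        deriv (rayLoop ε A) t = rayLoop ε A t * (a • (1 : Mat n)) := by
      rcases lt_or_gt_of_ne ht with h1 | h1
      · refine ⟨ε, rfl, ?_⟩
        have h2 : rayLoop ε A =ᶠ[nhds t] fun s => Real.exp (ε * s + 0) • A := by
          filter_upwards [gt_mem_nhds h1] with s hs using rayLoop_of_le hs.le A
        have h3 : deriv (rayLoop ε A) t = _ :=
          ((hasDerivAt_exp_affine_smul ε 0 A t).congr_of_eventuallyEq h2).deriv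
        rw [h3, rayLoop_of_le h1.le]
        simp
      · refine ⟨-ε, by ring, ?_⟩
        have h2 : rayLoop ε A =ᶠ[nhds t] fun s => Real.exp (-ε * s + 2 * ε) • A := by
          filter_upwards [lt_mem_nhds h1] with s hs using rayLoop_of_ge hs.le A
        have h3 : deriv (rayLoop ε A) t = _ :=
          ((hasDerivAt_exp_affine_smul (-ε) (2 * ε) A t).congr_of_eventuallyEq h2).deriv
        rw [h3, rayLoop_of_ge h1.le]
        simp
    rw [hd, isoMetric, inv_mul_mul_cancel (det_rayLoop_ne_zero hA t), isoInner_smul_one, ha,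
      Real.sqrt_mul (sq_nonneg _), Real.sqrt_sq hε.le]
  rw [curveLength, intervalIntegral.integral_congr_ae (g := fun _ => ε * √(κ * n))]
  · rw [intervalIntegral.integral_const, smul_eq_mul, sub_zero]
  · filter_upwards [MeasureTheory.Measure.ae_ne MeasureTheory.volume (1 : ℝ)] with t ht _ using h t ht

end Loop

/-- The length of an explicit geodesic bounds the geodesic distance. -/
theorem geodDist_le_isoNorm [NeZero n] {ω : ℝ} {A B M : Mat n} (hA : A.det ≠ 0)
    (h : M ∈ geodSolutions ω A B) :
    geodDist (isoMetric μ μc κ) A B ≤ ENNReal.ofReal (isoNorm μ μc κ M) := by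
  by_cases hM : M = 0
  -- For `M = 0` the explicit curve is constant, hence not admissible. Loops of length `2 ε √(κ n)`
  -- still push the infimum to `0`.
  · have hAB : A = B := by
      simpa [geodSolutions, hM, symPart, skewPart] using h
    subst hAB
    have key : ∀ ε : ℝ, 0 < ε → geodDist (isoMetric μ μc κ) A A ≤
        ENNReal.ofReal (2 * (ε * √(κ * n))) := fun ε hε =>
      sInf_le ⟨0, 2, rayLoop ε A, isAdmissible_rayLoop hε hA, by rw [curveLength_rayLoop hε hA]⟩
    have hlim : Filter.Tendsto (fun ε : ℝ => ENNReal.ofReal (2 * (ε * √(κ * n))))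
        (nhdsWithin 0 (Set.Ioi 0)) (nhds 0) := by
      have : Filter.Tendsto (fun ε : ℝ => ENNReal.ofReal (2 * (ε * √(κ * n)))) (nhds 0)
          (nhds (ENNReal.ofReal (2 * (0 * √(κ * n))))) :=
        (ENNReal.continuous_ofReal.comp (by fun_prop)).tendsto _
      simpa using this.mono_left nhdsWithin_le_nhds
    refine (ge_of_tendsto hlim ?_).trans zero_le
    filter_upwards [self_mem_nhdsWithin] with ε hε using key ε hε
  · exact sInf_le ⟨0, 1, geodCurve ω A M, isAdmissible_geodCurve hA hM h, by
      rw [curveLength_geodCurve hA]⟩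

end GLGeod

namespace GLGeod

open scoped Matrix Matrix.Norms.Frobenius
open MeasureTheory

attribute [local instance] frobTopology

variable {n : ℕ} {μ μc κ : ℝ}

/-! ### From curves to chains of small steps. -/

section CurveChain

/-- A continuous curve of invertible matrices that is differentiable off a countable set and whose
derivative is integrable. -/
structure IsRectifiableCurve (X : ℝ → Mat n) (a b : ℝ) : Prop where
  le : a ≤ b
  continuousOn : ContinuousOn X (Set.Icc a b)
  det_ne_zero : ∀ t ∈ Set.Icc a b, (X t).det ≠ 0
  hasDerivAt : ∃ s : Set ℝ, s.Countable ∧ ∀ t ∈ Set.Ioo a b \ s, HasDerivAt X (deriv X t) t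
  integrable : IntervalIntegrable (deriv X) volume a b

lemma exists_mem_Ioo_of_notMem_range {p : ℕ → ℝ} {t : ℝ} (ht : t ∉ Set.range p) (m : ℕ)
    (h0 : p 0 < t) (hm : t < p m) : ∃ j < m, t ∈ Set.Ioo (p j) (p (j + 1)) := by
  induction m with
  | zero => exact absurd h0 hm.not_gt
  | succ m ih =>
    rcases lt_trichotomy t (p m) with h | h | h
    · obtain ⟨j, hj, hjt⟩ := ih h
      exact ⟨j, by omega, hjt⟩
    · exact absurd ⟨m, h.symm⟩ ht
    · exact ⟨m, by omega, h, hm⟩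

lemma IsAdmissible.isRectifiableCurve {A B : Mat n} {a b : ℝ} {X : ℝ → Mat n}
    (h : IsAdmissible A B a b X) : IsRectifiableCurve X a b := by
  obtain ⟨m, p, rfl, rfl, hp⟩ := h.piecewise
  have hderiv : ∀ j ≤ m, ∀ X' : ℝ → Mat n, (∀ t ∈ Set.Icc (p j) (p (j + 1)),
      HasDerivWithinAt X (X' t) (Set.Icc (p j) (p (j + 1))) t) →
      ∀ t ∈ Set.Ioo (p j) (p (j + 1)), HasDerivAt X (X' t) t := fun j _ X' hX' t ht =>
    (hX' t (Set.Ioo_subset_Icc_self ht)).hasDerivAt (Icc_mem_nhds ht.1 ht.2)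
  have hle : ∀ j ≤ m + 1, p 0 ≤ p j := by
    intro j
    induction j with
    | zero => simp
    | succ j ih => exact fun hj => (ih (by omega)).trans (hp j (by omega)).1.le
  -- The exceptional set is the range of the whole sequence `p`; values beyond the partition do no
  -- harm, as countability suffices.
  refine ⟨hle _ le_rfl, h.continuousOn, h.det_ne_zero,
    ⟨Set.range p, Set.countable_range p, fun t ht => ?_⟩, ?_⟩
  · obtain ⟨j, hj, hjt⟩ := exists_mem_Ioo_of_notMem_range ht.2 (m + 1) ht.1.1 ht.1.2
    obtain ⟨X', hX', -, -⟩ := (hp j (by omega)).2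
    have := hderiv j (by omega) X' hX' t hjt
    exact this.differentiableAt.hasDerivAt
  · refine IntervalIntegrable.trans_iterate fun j hj => ?_
    obtain ⟨hlt, X', hX', hc, -⟩ := hp j (by omega)
    have h1 : IntervalIntegrable X' volume (p j) (p (j + 1)) :=
      ContinuousOn.intervalIntegrable_of_Icc hlt.le hc
    refine h1.congr_ae ?_
    rw [Set.uIoc_of_le hlt.le, Filter.EventuallyEq, ae_restrict_iff' measurableSet_Ioc]
    filter_upwards [Measure.ae_ne volume (p (j + 1))] with t ht htm
    exact (hderiv j (by omega) X' hX' t ⟨htm.1, lt_of_le_of_ne htm.2 ht⟩).deriv.symm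

lemma isRectifiableCurve_of_contDiff {X : ℝ → Mat n} (hX : ContDiff ℝ 1 X)
    (hdet : ∀ t ∈ Set.Icc (0 : ℝ) 1, (X t).det ≠ 0) : IsRectifiableCurve X 0 1 where
  le := zero_le_one
  continuousOn := hX.continuous.continuousOn
  det_ne_zero := hdet
  hasDerivAt := ⟨∅, Set.countable_empty, fun t _ =>
    (hX.differentiable one_ne_zero t).hasDerivAt⟩
  integrable := (hX.continuous_deriv le_rfl).intervalIntegrable _ _

lemma intervalIntegrable_clm_comp (T : Mat n →L[ℝ] Mat n) {f : ℝ → Mat n} {a b : ℝ}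
    (hf : IntervalIntegrable f volume a b) : IntervalIntegrable (fun t => T (f t)) volume a b :=
  ⟨T.integrable_comp hf.1, T.integrable_comp hf.2⟩

variable {X : ℝ → Mat n} {a b : ℝ}

lemma IsRectifiableCurve.intervalIntegrable_speed [NeZero n] (hμ : 0 < μ) (hμc : 0 < μc)
    (hκ : 0 < κ) (h : IsRectifiableCurve X a b) :
    IntervalIntegrable (fun t => isoNorm μ μc κ ((X t)⁻¹ * deriv X t)) volume a b := by
  have h1 : ContinuousOn (fun t => (X t)⁻¹) (Set.uIcc a b) := by
    rw [Set.uIcc_of_le h.le]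
    intro t ht
    have h0 : ContinuousAt Inv.inv (X t) := continuousAt_matrix_inv (X t)
      (NormedRing.inverse_continuousAt (Units.mk0 _ (h.det_ne_zero t ht)))
    exact h0.comp_continuousWithinAt (h.continuousOn t ht)
  have h2 := h.integrable.continuousOn_mul h1
  simp only [isoNorm_eq hμ hμc hκ]
  exact (intervalIntegrable_clm_comp _ h2).norm

/-- A curve of length `ℓ` moves by at most `ℓ / (1 - c ℓ)`. -/
lemma IsRectifiableCurve.isoNorm_sub_one_le [NeZero n] (hμ : 0 < μ) (hμc : 0 < μc)
    (hκ : 0 < κ) (h : IsRectifiableCurve X a b) {c : ℝ} (hc : 0 < c)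
    (hmul : ∀ M N : Mat n, isoNorm μ μc κ (M * N) ≤ c * isoNorm μ μc κ M * isoNorm μ μc κ N)
    {s t : ℝ} (has : a ≤ s) (hst : s ≤ t) (htb : t ≤ b) {l : ℝ} (hcl : c * l < 1)
    (hl : ∫ τ in s..t, isoNorm μ μc κ ((X τ)⁻¹ * deriv X τ) = l) :
    isoNorm μ μc κ ((X s)⁻¹ * X t - 1) ≤ l / (1 - c * l) := by
  have hsub : Set.Icc s t ⊆ Set.Icc a b := Set.Icc_subset_Icc has htb
  have hsI : s ∈ Set.Icc a b := ⟨has, hst.trans htb⟩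
  have hspeed : ∀ {τ}, s ≤ τ → τ ≤ t →
      IntervalIntegrable (fun t => isoNorm μ μc κ ((X t)⁻¹ * deriv X t)) volume s τ :=
    fun h1 h2 => (h.intervalIntegrable_speed hμ hμc hκ).mono_set (by
      rw [Set.uIcc_of_le h1, Set.uIcc_of_le h.le]
      exact Set.Icc_subset_Icc has (h2.trans htb))
  have hcont : ContinuousOn (fun τ => (X s)⁻¹ * X τ - 1) (Set.Icc s t) :=
    (continuousOn_const.mul (h.continuousOn.mono hsub)).sub continuousOn_const
  -- Let `m` be the maximal deviation on `[s, t]`. Writing `X_s⁻¹ X' = X_τ⁻¹ X' + (X_s⁻¹ X_τ - 1)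
  -- X_τ⁻¹ X'` and integrating gives `m ≤ (1 + c m) l`, which is solved for `m`.
  obtain ⟨τ₀, hτ₀, hmax⟩ := isCompact_Icc.exists_isMaxOn (Set.nonempty_Icc.2 hst)
    ((continuous_isoNorm hμ hμc hκ).comp_continuousOn hcont)
  set m := isoNorm μ μc κ ((X s)⁻¹ * X τ₀ - 1) with hm
  have hm0 : 0 ≤ m := isoNorm_nonneg _
  have hpt : ∀ τ ∈ Set.Icc s t, isoNorm μ μc κ ((X s)⁻¹ * deriv X τ)
      ≤ (1 + c * m) * isoNorm μ μc κ ((X τ)⁻¹ * deriv X τ) := by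
    intro τ hτ
    have h1 : (X s)⁻¹ * deriv X τ = (X τ)⁻¹ * deriv X τ
        + ((X s)⁻¹ * X τ - 1) * ((X τ)⁻¹ * deriv X τ) := by
      rw [sub_mul, one_mul, mul_assoc, Matrix.mul_nonsing_inv_cancel_left _ _
        (isUnit_iff_ne_zero.2 (h.det_ne_zero τ (hsub hτ)))]
      abel
    rw [h1]
    refine (isoNorm_add_le hμ hμc hκ _ _).trans ?_
    have h2 := hmul ((X s)⁻¹ * X τ - 1) ((X τ)⁻¹ * deriv X τ)
    have h3 : isoNorm μ μc κ ((X s)⁻¹ * X τ - 1) ≤ m := hmax hτ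
    have h4 : c * isoNorm μ μc κ ((X s)⁻¹ * X τ - 1) * isoNorm μ μc κ ((X τ)⁻¹ * deriv X τ)
        ≤ c * m * isoNorm μ μc κ ((X τ)⁻¹ * deriv X τ) := by
      gcongr
      exact isoNorm_nonneg _
    linarith
  have hbound : ∀ τ ∈ Set.Icc s t, isoNorm μ μc κ ((X s)⁻¹ * X τ - 1) ≤ (1 + c * m) * l := by
    intro τ hτ
    obtain ⟨S, hS, hd⟩ := h.hasDerivAt
    -- The image under the square-root operator is integrated, so that the Frobenius estimate for
    -- the integral becomes one for the isotropic norm.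
    have hftc : ∫ σ in s..τ, isoOp √μ √μc √κ ((X s)⁻¹ * deriv X σ)
        = isoOp √μ √μc √κ ((X s)⁻¹ * X τ - 1) - isoOp √μ √μc √κ ((X s)⁻¹ * X s - 1) := by
      refine integral_eq_of_hasDerivAt_off_countable
        (fun σ => isoOp √μ √μc √κ ((X s)⁻¹ * X σ - 1)) _ hS ?_ ?_ ?_
      · rw [Set.uIcc_of_le hτ.1]
        exact (isoOp _ _ _).continuous.comp_continuousOn
          (hcont.mono (Set.Icc_subset_Icc_right hτ.2))
      · intro σ hσ
        rw [min_eq_left hτ.1, max_eq_right hτ.1] at hσ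
        have h1 := hd σ ⟨⟨has.trans_lt hσ.1.1, hσ.1.2.trans_le (hτ.2.trans htb)⟩, hσ.2⟩
        exact (isoOp √μ √μc √κ).hasFDerivAt.comp_hasDerivAt σ
          ((h1.const_mul (X s)⁻¹).sub_const 1)
      · have h1 : IntervalIntegrable (deriv X) volume s τ := h.integrable.mono_set (by
          rw [Set.uIcc_of_le hτ.1, Set.uIcc_of_le h.le]
          exact Set.Icc_subset_Icc has (hτ.2.trans htb))
        exact intervalIntegrable_clm_comp _
          (h1.continuousOn_mul continuousOn_const)
    rw [Matrix.nonsing_inv_mul _ (isUnit_iff_ne_zero.2 (h.det_ne_zero s hsI)), sub_self, map_zero,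
      sub_zero] at hftc
    rw [isoNorm_eq hμ hμc hκ, ← hftc]
    calc _ ≤ ∫ σ in s..τ, (1 + c * m) * isoNorm μ μc κ ((X σ)⁻¹ * deriv X σ) := by
          refine intervalIntegral.norm_integral_le_of_norm_le hτ.1 (ae_of_all _ fun σ hσ => ?_)
            ((hspeed hτ.1 hτ.2).const_mul _)
          rw [← isoNorm_eq hμ hμc hκ]
          exact hpt σ ⟨hσ.1.le, hσ.2.trans hτ.2⟩
      _ = (1 + c * m) * ∫ σ in s..τ, isoNorm μ μc κ ((X σ)⁻¹ * deriv X σ) :=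
        intervalIntegral.integral_const_mul _ _
      _ ≤ (1 + c * m) * l := by
        rw [← hl]
        gcongr
        refine intervalIntegral.integral_mono_interval le_rfl hτ.1 hτ.2 ?_ (hspeed hst le_rfl)
        exact ae_of_all _ fun σ => isoNorm_nonneg _
  have h1 : m ≤ (1 + c * m) * l := hbound τ₀ hτ₀
  have h2 : isoNorm μ μc κ ((X s)⁻¹ * X t - 1) ≤ m := hmax ⟨hst, le_rfl⟩
  refine h2.trans ?_
  rw [le_div_iff₀ (by linarith)]
  linarith

/-- The product `A (1 + g 0) ⋯ (1 + g (k - 1))`. -/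
def chain (A : Mat n) (g : ℕ → Mat n) : ℕ → Mat n
  | 0 => A
  | k + 1 => chain A g k * (1 + g k)

lemma chain_nodes {A : Mat n} (N : ℕ) {x : ℕ → Mat n} (h0 : x 0 = A)
    (hx : ∀ i ≤ N, (x i).det ≠ 0) : chain A (fun i => (x i)⁻¹ * x (i + 1) - 1) N = x N := by
  induction N with
  | zero => simp [chain, h0]
  | succ k ih =>
    rw [chain, ih fun i hi => hx i (by omega), add_sub_cancel, Matrix.mul_nonsing_inv_cancel_left _ _
      (isUnit_iff_ne_zero.2 (hx k (by omega)))]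

/-- A curve of length `l` is discretised into `N` steps of size about `l / N`. -/
lemma IsRectifiableCurve.exists_chain [NeZero n] (hμ : 0 < μ) (hμc : 0 < μc) (hκ : 0 < κ)
    (h : IsRectifiableCurve X a b) {c : ℝ} (hc : 0 < c)
    (hmul : ∀ M N : Mat n, isoNorm μ μc κ (M * N) ≤ c * isoNorm μ μc κ M * isoNorm μ μc κ N)
    {l : ℝ} (hl : ∫ τ in a..b, isoNorm μ μc κ ((X τ)⁻¹ * deriv X τ) = l) {N : ℕ}
    (hN : 0 < N) (hlN : c * (l / N) < 1) :
    ∃ g : ℕ → Mat n, chain (X a) g N = X b ∧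
      ∀ i < N, isoNorm μ μc κ (g i) ≤ (l / N) / (1 - c * (l / N)) := by
  have hN' : (0 : ℝ) < N := by exact_mod_cast hN
  set f : ℝ → ℝ := fun t => ∫ τ in a..t, isoNorm μ μc κ ((X τ)⁻¹ * deriv X τ) with hf
  have hint := h.intervalIntegrable_speed hμ hμc hκ
  have hsub : ∀ {s t}, s ∈ Set.Icc a b → t ∈ Set.Icc a b →
      IntervalIntegrable (fun t => isoNorm μ μc κ ((X t)⁻¹ * deriv X t)) volume s t :=
    fun hs ht => hint.mono_set (by
      rw [Set.uIcc_of_le h.le]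
      exact Set.uIcc_subset_Icc hs ht)
  have haI : a ∈ Set.Icc a b := ⟨le_rfl, h.le⟩
  have hbI : b ∈ Set.Icc a b := ⟨h.le, le_rfl⟩
  have hadj : ∀ {s t}, s ∈ Set.Icc a b → t ∈ Set.Icc a b →
      ∫ τ in s..t, isoNorm μ μc κ ((X τ)⁻¹ * deriv X τ) = f t - f s := fun hs ht =>
    (intervalIntegral.integral_interval_sub_left (hsub haI ht) (hsub haI hs)).symm
  have hmono : ∀ {s t}, s ∈ Set.Icc a b → t ∈ Set.Icc a b → s ≤ t → f s ≤ f t :=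
    fun hs ht hst => by
      rw [← sub_nonneg, ← hadj hs ht]
      exact intervalIntegral.integral_nonneg hst fun _ _ => isoNorm_nonneg _
  have hfa : f a = 0 := intervalIntegral.integral_same
  have hfb : f b = l := hl
  have hl0 : 0 ≤ l := by rw [← hfa, ← hfb]; exact hmono haI hbI h.le
  -- The arc length `f` may fail to be injective, but `X` takes equal values where `f` does: this is
  -- the displacement estimate with `l = 0`.
  have heq : ∀ {s t}, s ∈ Set.Icc a b → t ∈ Set.Icc a b → s ≤ t → f s = f t → X s = X t := by
    intro s t hs ht hst hfst
    have h1 := h.isoNorm_sub_one_le hμ hμc hκ hc hmul hs.1 hst ht.2 (l := 0) (by simp)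
      (by rw [hadj hs ht, hfst, sub_self])
    rw [zero_div] at h1
    have h2 := sub_eq_zero.1 (isoNorm_eq_zero hμ hμc hκ h1)
    calc X s = X s * ((X s)⁻¹ * X t) := by rw [h2, mul_one]
      _ = X t := Matrix.mul_nonsing_inv_cancel_left _ _
        (isUnit_iff_ne_zero.2 (h.det_ne_zero s hs))
  have hcont : ContinuousOn f (Set.Icc a b) := by
    have := intervalIntegral.continuousOn_primitive_interval' hint Set.left_mem_uIcc
    rwa [Set.uIcc_of_le h.le] at this
  -- Nodes at equally spaced arc lengths. The node `a` for `i > N` is a dummy that only makes the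
  -- choice total.
  have hnode : ∀ i : ℕ, ∃ t ∈ Set.Icc a b, i ≤ N → f t = i * (l / N) := by
    intro i
    by_cases hi : i ≤ N
    · have hi' : (i : ℝ) ≤ N := by exact_mod_cast hi
      have : (i : ℝ) * (l / N) ∈ Set.Icc (f a) (f b) := by
        rw [hfa, hfb]
        refine ⟨by positivity, ?_⟩
        calc (i : ℝ) * (l / N) ≤ N * (l / N) := by gcongr
          _ = l := by field_simp
      obtain ⟨t, ht, hft⟩ := intermediate_value_Icc h.le hcont this
      exact ⟨t, ht, fun _ => hft⟩
    · exact ⟨a, haI, fun h => absurd h hi⟩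
  choose t ht hft using hnode
  have h0 : X (t 0) = X a := (heq haI (ht 0) (ht 0).1 (by rw [hft 0 (by omega), hfa]; simp)).symm
  have hNb : X (t N) = X b := heq (ht N) hbI (ht N).2 (by
    rw [hft N le_rfl, hfb]; field_simp)
  refine ⟨fun i => (X (t i))⁻¹ * X (t (i + 1)) - 1, ?_, fun i hi => ?_⟩
  · rw [chain_nodes N (x := fun i => X (t i)) h0 fun i _ => h.det_ne_zero _ (ht i), hNb]
  · have hstep : f (t (i + 1)) - f (t i) = l / N := by
      rw [hft i (by omega), hft (i + 1) (by omega)]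
      push_cast
      ring
    rcases le_total (t i) (t (i + 1)) with hle | hle
    · exact h.isoNorm_sub_one_le hμ hμc hκ hc hmul (ht i).1 hle (ht (i + 1)).2 hlN
        (by rw [hadj (ht i) (ht (i + 1)), hstep])
    -- Chosen nodes need not be ordered. In reversed order monotonicity forces `f` to agree at both,
    -- so the step is trivial.
    · have h1 := hmono (ht (i + 1)) (ht i) hle
      have h2 : 0 ≤ l / N := by positivity
      have h3 : X (t (i + 1)) = X (t i) := heq (ht (i + 1)) (ht i) hle (by linarith)
      have h4 : (X (t i))⁻¹ * X (t i) = 1 :=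
        Matrix.nonsing_inv_mul _ (isUnit_iff_ne_zero.2 (h.det_ne_zero _ (ht i)))
      simp only [h3, h4, sub_self, isoNorm_eq hμ hμc hκ, map_zero, norm_zero]
      exact div_nonneg h2 (by linarith)

end CurveChain

/-! ### Connectedness of the matrices of positive determinant. -/

section Connected

/-- `C` is joined to the identity by a continuously differentiable curve of invertible matrices. -/
def JoinedToOne (C : Mat n) : Prop :=
  ∃ γ : ℝ → Mat n, ContDiff ℝ 1 γ ∧ (∀ t ∈ Set.Icc (0 : ℝ) 1, (γ t).det ≠ 0) ∧ γ 0 = 1 ∧ γ 1 = C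

lemma JoinedToOne.mul {C D : Mat n} (hC : JoinedToOne C) (hD : JoinedToOne D) :
    JoinedToOne (C * D) := by
  obtain ⟨γ, h1, h2, h3, h4⟩ := hC
  obtain ⟨δ, h1', h2', h3', h4'⟩ := hD
  refine ⟨fun t => γ t * δ t, h1.mul h1', fun t ht => ?_, by simp [h3, h3'], by simp [h4, h4']⟩
  rw [Matrix.det_mul]
  exact mul_ne_zero (h2 t ht) (h2' t ht)

lemma joinedToOne_of_affine {C : Mat n}
    (h : ∀ t ∈ Set.Icc (0 : ℝ) 1, ((1 : Mat n) + t • (C - 1)).det ≠ 0) : JoinedToOne C :=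
  ⟨fun t => 1 + t • (C - 1), contDiff_const.add (contDiff_id.smul contDiff_const), h,
    by simp, by simp⟩

lemma joinedToOne_transvection {i j : Fin n} (hij : i ≠ j) (c : ℝ) :
    JoinedToOne (Matrix.transvection i j c) := by
  refine joinedToOne_of_affine fun t _ => ?_
  have h : (1 : Mat n) + t • (Matrix.transvection i j c - 1) = Matrix.transvection i j (t * c) := by
    simp [Matrix.transvection]
  rw [h, Matrix.det_transvection_of_ne _ _ hij]
  exact one_ne_zero

lemma joinedToOne_diagonal_of_pos {d : Fin n → ℝ} (hd : ∀ i, 0 < d i) :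
    JoinedToOne (Matrix.diagonal d) := by
  refine joinedToOne_of_affine fun t ht => ?_
  have h : (1 : Mat n) + t • (Matrix.diagonal d - 1)
      = Matrix.diagonal fun i => 1 + t * (d i - 1) := by
    ext i j
    rcases eq_or_ne i j with rfl | hij
    · simp
    · simp [hij]
  rw [h, Matrix.det_diagonal]
  refine Finset.prod_ne_zero_iff.2 fun i _ => ne_of_gt ?_
  rcases eq_or_lt_of_le ht.2 with h1 | h1
  · have := hd i
    rw [h1]
    linarith
  · have := mul_nonneg ht.1 (hd i).le
    linarith

lemma JoinedToOne.conj {C D : Mat n} (hC : JoinedToOne C) (hD : D * D = 1) :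
    JoinedToOne (D * C * D) := by
  obtain ⟨γ, h1, h2, h3, h4⟩ := hC
  have hD0 : D.det ≠ 0 := fun h => by
    have := congrArg Matrix.det hD
    rw [Matrix.det_mul, h, Matrix.det_one, zero_mul] at this
    exact zero_ne_one this
  refine ⟨fun t => D * γ t * D, (contDiff_const.mul h1).mul contDiff_const, fun t ht => ?_,
    by simp [h3, hD], by simp [h4]⟩
  rw [Matrix.det_mul, Matrix.det_mul]
  exact mul_ne_zero (mul_ne_zero hD0 (h2 t ht)) hD0

lemma JoinedToOne.det_pos {C : Mat n} (hC : JoinedToOne C) : 0 < C.det := by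
  obtain ⟨γ, h1, h2, h3, rfl⟩ := hC
  by_contra! hneg
  have hcont : ContinuousOn (fun t => (γ t).det) (Set.Icc 0 1) :=
    (Continuous.matrix_det h1.continuous).continuousOn
  obtain ⟨t, ht, h0⟩ := intermediate_value_Icc' zero_le_one hcont
    (show (0 : ℝ) ∈ Set.Icc _ _ from ⟨hneg, by simp [h3]⟩)
  exact h2 t ht h0

/-- The reflection in the `i`-th coordinate. -/
def coordFlip (i : Fin n) : Mat n := Matrix.diagonal fun k => if k = i then -1 else 1

lemma coordFlip_mul_self (i : Fin n) : coordFlip i * coordFlip i = 1 := by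
  rw [coordFlip, Matrix.diagonal_mul_diagonal, ← Matrix.diagonal_one]
  congr 1
  funext k
  split_ifs <;> simp

lemma det_coordFlip (i : Fin n) : (coordFlip i).det = -1 := by
  rw [coordFlip, Matrix.det_diagonal, Finset.prod_ite_eq']
  simp

/-- The product of three transvections `w` is a quarter turn in the `(i, j)`-plane. Its square is
the half turn, which flips both coordinates. -/
lemma joinedToOne_coordFlip_mul_coordFlip {i j : Fin n} (hij : i ≠ j) :
    JoinedToOne (coordFlip i * coordFlip j) := by
  have hw := ((joinedToOne_transvection hij 1).mul (joinedToOne_transvection hij.symm (-1))).mul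
    (joinedToOne_transvection hij 1)
  convert hw.mul hw using 1
  set e : Mat n := Matrix.single i j 1 with he
  set f : Mat n := Matrix.single j i 1 with hf
  have hee : e * e = 0 := Matrix.single_mul_single_of_ne _ _ _ _ hij.symm _
  have hff : f * f = 0 := Matrix.single_mul_single_of_ne _ _ _ _ hij _
  have hef : e * f = Matrix.single i i 1 := by simp [he, hf]
  have hfe : f * e = Matrix.single j j 1 := by simp [he, hf]
  have hefe : e * f * e = e := by rw [hef]; simp [he]
  have hfef : f * e * f = f := by rw [hfe]; simp [hf]
  have hneg : Matrix.single j i (-1 : ℝ) = -f := by rw [hf, Matrix.single_neg]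
  have h1 : coordFlip i * coordFlip j = 1 - 2 • (e * f) - 2 • (f * e) := by
    rw [hef, hfe, coordFlip, coordFlip, Matrix.diagonal_mul_diagonal]
    ext a b
    rcases eq_or_ne a b with rfl | hab
    · by_cases h1 : a = i
      · subst h1
        simp [hij, hij.symm]
        norm_num
      · by_cases h2 : a = j
        · subst h2
          simp [h1, Ne.symm h1]
          norm_num
        · simp [h1, h2, Ne.symm h1, Ne.symm h2]
    · have h3 : ∀ (k : Fin n) (r : ℝ), (Matrix.single k k r : Mat n) a b = 0 := fun k r =>
        Matrix.single_apply_of_ne _ _ _ _ _ (by rintro ⟨rfl, rfl⟩; exact hab rfl)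
      simp [hab, h3]
  have h2 : Matrix.transvection i j 1 * Matrix.transvection j i (-1) * Matrix.transvection i j 1
      = 1 + e - f - e * f - f * e := by
    simp only [Matrix.transvection, hneg, ← he]
    calc _ = 1 + e - f - e * f - f * e + (e - e * f * e) + e * e := by noncomm_ring
      _ = _ := by rw [hefe, hee]; simp
  rw [h1, h2]
  have h3 : e * (f * e) = e := by rw [← mul_assoc, hefe]
  have h4 : f * (e * f) = f := by rw [← mul_assoc, hfef]
  simp only [mul_add, add_mul, mul_sub, sub_mul, one_mul, mul_one, mul_assoc, hee, hff, h3, h4,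
    mul_zero]
  simp only [← mul_assoc e e, ← mul_assoc f f, hee, hff, zero_mul, mul_zero]
  abel

lemma joinedToOne_one : JoinedToOne (1 : Mat n) :=
  joinedToOne_of_affine fun t _ => by simp

variable [NeZero n]

/-- The alternative is stable under products because conjugation by the flip preserves
`JoinedToOne`. It holds for transvections, positive diagonals and single flips, and these generate
all invertible matrices. -/
lemma joinedToOne_or_mul_coordFlip (M : Mat n) (hM : M.det ≠ 0) :
    JoinedToOne M ∨ JoinedToOne (M * coordFlip 0) := by
  have hmul : ∀ C D : Mat n, (JoinedToOne C ∨ JoinedToOne (C * coordFlip 0)) →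
      (JoinedToOne D ∨ JoinedToOne (D * coordFlip 0)) →
      (JoinedToOne (C * D) ∨ JoinedToOne (C * D * coordFlip 0)) := by
    have hF := coordFlip_mul_self (0 : Fin n)
    rintro C D (hC | hC) (hD | hD)
    · exact Or.inl (hC.mul hD)
    · exact Or.inr (by simpa only [mul_assoc] using hC.mul hD)
    · refine Or.inr ?_
      have h := hC.mul (hD.conj hF)
      rwa [show C * coordFlip 0 * (coordFlip 0 * D * coordFlip 0)
        = C * (coordFlip 0 * coordFlip 0) * D * coordFlip 0 by noncomm_ring, hF, mul_one] at h
    · refine Or.inl ?_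
      have h := hC.mul (hD.conj hF)
      rwa [show C * coordFlip 0 * (coordFlip 0 * (D * coordFlip 0) * coordFlip 0)
        = C * (coordFlip 0 * coordFlip 0) * D * (coordFlip 0 * coordFlip 0) by noncomm_ring, hF,
        mul_one, mul_one] at h
  have hflip : ∀ i : Fin n, JoinedToOne (coordFlip i) ∨ JoinedToOne (coordFlip i * coordFlip 0) := by
    intro i
    right
    by_cases hi : i = 0
    · rw [hi, coordFlip_mul_self]
      exact joinedToOne_one
    · exact joinedToOne_coordFlip_mul_coordFlip hi
  have hsign : ∀ s : Finset (Fin n),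
      JoinedToOne (Matrix.diagonal fun k => if k ∈ s then (-1 : ℝ) else 1) ∨
      JoinedToOne (Matrix.diagonal (fun k => if k ∈ s then (-1 : ℝ) else 1) * coordFlip 0) := by
    intro s
    induction s using Finset.induction_on with
    | empty =>
      left
      simpa using joinedToOne_one
    | insert i s hi ih =>
      have heq : coordFlip i * Matrix.diagonal (fun k => if k ∈ s then (-1 : ℝ) else 1)
          = Matrix.diagonal fun k => if k ∈ insert i s then (-1 : ℝ) else 1 := by
        rw [coordFlip, Matrix.diagonal_mul_diagonal]
        congr 1
        funext k
        by_cases hk : k = i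
        · subst hk
          simp [hi]
        · simp [hk]
      rw [← heq]
      exact hmul _ _ (hflip i) ih
  refine Matrix.diagonal_transvection_induction_of_det_ne_zero
    (fun M => JoinedToOne M ∨ JoinedToOne (M * coordFlip 0)) M hM ?_ ?_ ?_
  · intro d hd
    rw [Matrix.det_diagonal, Finset.prod_ne_zero_iff] at hd
    have h := hmul _ _ (Or.inl (joinedToOne_diagonal_of_pos (d := fun i => |d i|)
      fun i => abs_pos.2 (hd i (Finset.mem_univ i)))) (hsign {i | d i < 0})
    have heq : (Matrix.diagonal fun i => |d i|) *
        (Matrix.diagonal fun k => if k ∈ ({i | d i < 0} : Finset (Fin n)) then (-1 : ℝ) else 1)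
        = Matrix.diagonal d := by
      rw [Matrix.diagonal_mul_diagonal]
      congr 1
      funext k
      by_cases hk : d k < 0
      · simp [hk, abs_of_neg]
      · simp [hk, abs_of_nonneg (not_lt.1 hk)]
    rwa [heq] at h
  · exact fun t => Or.inl (joinedToOne_transvection t.hij t.c)
  · exact fun C D _ _ hC hD => hmul C D hC hD

/-- The sign of the determinant is constant along a path in `GL(n)`, which excludes the flipped
alternative. -/
lemma joinedToOne_of_det_pos {C : Mat n} (hC : 0 < C.det) : JoinedToOne C := by
  refine (joinedToOne_or_mul_coordFlip C hC.ne').resolve_right fun h => ?_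
  have := h.det_pos
  rw [Matrix.det_mul, det_coordFlip] at this
  linarith

/-- Matrices of positive determinant are joined by a rectifiable curve of invertible matrices. -/
lemma exists_isRectifiableCurve {A B : Mat n} (hA : 0 < A.det) (hB : 0 < B.det) :
    ∃ X : ℝ → Mat n, IsRectifiableCurve X 0 1 ∧ X 0 = A ∧ X 1 = B := by
  have hdet : 0 < (A⁻¹ * B).det := by
    rw [Matrix.det_mul, Matrix.det_nonsing_inv, Ring.inverse_eq_inv']
    positivity
  obtain ⟨γ, h1, h2, h3, h4⟩ := joinedToOne_of_det_pos hdet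
  refine ⟨fun t => A * γ t, isRectifiableCurve_of_contDiff (contDiff_const.mul h1) fun t ht => ?_,
    by simp [h3], ?_⟩
  · rw [Matrix.det_mul]
    exact mul_ne_zero hA.ne' (h2 t ht)
  · simp only [h4]
    exact Matrix.mul_nonsing_inv_cancel_left _ _ (isUnit_iff_ne_zero.2 hA.ne')

end Connected

/-! ### Chains of least energy and the discrete Euler–Lagrange equation. -/

section Minimiser

/-- The sum of the squared step sizes of a chain. -/
noncomputable def chainEnergy (μ μc κ : ℝ) (g : ℕ → Mat n) (N : ℕ) : ℝ :=
  ∑ i ∈ Finset.range N, isoNorm μ μc κ (g i) ^ 2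

lemma chain_congr (A : Mat n) {g h : ℕ → Mat n} {N : ℕ} (hgh : ∀ i < N, g i = h i) :
    chain A g N = chain A h N := by
  induction N with
  | zero => rfl
  | succ k ih => rw [chain, chain, ih fun i hi => hgh i (by omega), hgh k (by omega)]

lemma continuous_chain (A : Mat n) (N : ℕ) : Continuous fun g : ℕ → Mat n => chain A g N := by
  induction N with
  | zero => exact continuous_const
  | succ k ih => exact ih.mul (continuous_const.add (continuous_apply k))

/-- Among the chains of `N` steps joining two matrices there is one of least energy. -/
lemma exists_minimal_chain [NeZero n] (hμ : 0 < μ) (hμc : 0 < μc) (hκ : 0 < κ) {A B : Mat n}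
    {N : ℕ} (hex : ∃ g, chain A g N = B) :
    ∃ g, chain A g N = B ∧
      ∀ h, chain A h N = B → chainEnergy μ μc κ g N ≤ chainEnergy μ μc κ h N := by
  obtain ⟨g₀, hg₀⟩ := hex
  obtain ⟨K, hK, hKn⟩ := exists_norm_le_isoNorm (n := n) hμ hμc hκ
  set E := chainEnergy μ μc κ g₀ N with hE
  -- Each step of a chain of energy at most `E` has norm at most `K √E`. Steps beyond `N` do not
  -- matter and are set to `0`, which places the competitors in a compact product of balls.
  set S : Set (ℕ → Mat n) :=
    (Set.univ.pi fun _ => Metric.closedBall 0 (K * √E)) ∩ {g | chain A g N = B} with hS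
  have hScompact : IsCompact S :=
    (isCompact_univ_pi fun _ => isCompact_closedBall _ _).inter_right
      (isClosed_eq (continuous_chain A N) continuous_const)
  have htrunc : ∀ h, chain A h N = B → chainEnergy μ μc κ h N ≤ E →
      (fun i => if i < N then h i else 0) ∈ S := by
    intro h hh hle
    refine ⟨fun i _ => ?_, ?_⟩
    · rw [mem_closedBall_zero_iff]
      by_cases hi : i < N
      · simp only [hi, if_true]
        refine (hKn _).trans ?_
        gcongr
        refine Real.le_sqrt_of_sq_le (le_trans ?_ hle)
        exact Finset.single_le_sum (f := fun i => isoNorm μ μc κ (h i) ^ 2)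
          (fun _ _ => sq_nonneg _) (Finset.mem_range.2 hi)
      · simp only [hi, if_false, norm_zero]
        positivity
    · change chain A _ N = B
      rw [← hh]
      exact chain_congr A fun i hi => by simp [hi]
  have henergy : ∀ h : ℕ → Mat n, chainEnergy μ μc κ (fun i => if i < N then h i else 0) N
      = chainEnergy μ μc κ h N := fun h =>
    Finset.sum_congr rfl fun i hi => by simp [Finset.mem_range.1 hi]
  have hcont : Continuous fun g : ℕ → Mat n => chainEnergy μ μc κ g N :=
    continuous_finsetSum _ fun i _ =>
      ((continuous_isoNorm hμ hμc hκ).comp (continuous_apply i)).pow 2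
  obtain ⟨g, hgS, hgmin⟩ := hScompact.exists_isMinOn ⟨_, htrunc g₀ hg₀ le_rfl⟩ hcont.continuousOn
  refine ⟨g, hgS.2, fun h hh => ?_⟩
  rcases le_total (chainEnergy μ μc κ h N) E with hle | hle
  · rw [← henergy h]
    exact hgmin (htrunc h hh hle)
  · refine le_trans ?_ hle
    rw [hE, ← henergy g₀]
    exact hgmin (htrunc g₀ hg₀ le_rfl)

lemma hasDerivAt_isoInner [NeZero n] {f : ℝ → Mat n} {f' : Mat n} {t : ℝ}
    (hf : HasDerivAt f f' t) :
    HasDerivAt (fun s => isoInner μ μc κ (f s) (f s)) (2 * isoInner μ μc κ (f t) f') t := by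
  have h1 : HasDerivAt (fun s => isoOp μ μc κ (f s)) (isoOp μ μc κ f') t :=
    (isoOp μ μc κ).hasFDerivAt.comp_hasDerivAt t hf
  have h2 : HasDerivAt (fun s => (isoOp μ μc κ (f s))ᵀ) (isoOp μ μc κ f')ᵀ t :=
    (LinearMap.toContinuousLinearMap
      (Matrix.transposeLinearEquiv (Fin n) (Fin n) ℝ ℝ).toLinearMap).hasFDerivAt.comp_hasDerivAt t h1
  have h3 := (LinearMap.toContinuousLinearMap
    (Matrix.traceLinearMap (Fin n) ℝ ℝ)).hasFDerivAt.comp_hasDerivAt t (h2.mul hf)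
  have h4 : HasDerivAt (fun s => isoInner μ μc κ (f s) (f s))
      (((isoOp μ μc κ f')ᵀ * f t + (isoOp μ μc κ (f t))ᵀ * f').trace) t := by
    refine HasDerivAt.congr_of_eventuallyEq h3 (Filter.Eventually.of_forall fun s => ?_)
    exact isoInner_eq_frobInner _ _ _ _ _
  refine h4.congr_deriv ?_
  rw [Matrix.trace_add]
  change frobInner _ _ + frobInner _ _ = _
  rw [← isoInner_eq_frobInner, ← isoInner_eq_frobInner, isoInner_comm _ _ _ f']
  ring

lemma sum_range_update {N i : ℕ} (hi : i < N) (g : ℕ → Mat n) (a : Mat n) (F : Mat n → ℝ) :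
    ∑ k ∈ Finset.range N, F (Function.update g i a k)
      = ∑ k ∈ Finset.range N, F (g k) - F (g i) + F a := by
  rw [← Finset.add_sum_erase _ _ (Finset.mem_range.2 hi),
    ← Finset.add_sum_erase (Finset.range N) (fun k => F (g k)) (Finset.mem_range.2 hi),
    Function.update_self]
  rw [Finset.sum_congr rfl fun k hk => by rw [Function.update_of_ne (Finset.ne_of_mem_erase hk)]]
  ring

/-- Changing two consecutive factors without changing their product moves only the node between
them. -/
lemma chain_update_update (A : Mat n) (g : ℕ → Mat n) {i N : ℕ} (hi : i + 1 < N) {a b : Mat n}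
    (h : (1 + a) * (1 + b) = (1 + g i) * (1 + g (i + 1))) :
    chain A (Function.update (Function.update g i a) (i + 1) b) N = chain A g N := by
  set g' := Function.update (Function.update g i a) (i + 1) b with hg'
  have h0 : chain A g' i = chain A g i := chain_congr A fun k hk => by
    rw [hg', Function.update_of_ne (by omega), Function.update_of_ne (by omega)]
  have hi' : g' i = a := by
    rw [hg', Function.update_of_ne (by omega), Function.update_self]
  have hi1 : g' (i + 1) = b := by rw [hg', Function.update_self]
  have key : ∀ k, chain A g' (i + 2 + k) = chain A g (i + 2 + k) := by
    intro k
    induction k with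
    | zero =>
      change chain A g' i * (1 + g' i) * (1 + g' (i + 1)) = chain A g i * (1 + g i) * (1 + g (i + 1))
      rw [h0, hi', hi1, mul_assoc, h, mul_assoc]
    | succ k ih =>
      change chain A g' (i + 2 + k) * (1 + g' (i + 2 + k)) = chain A g (i + 2 + k) *
        (1 + g (i + 2 + k))
      rw [ih, hg', Function.update_of_ne (by omega), Function.update_of_ne (by omega)]
  obtain ⟨k, rfl⟩ : ∃ k, N = i + 2 + k := ⟨N - (i + 2), by omega⟩
  exact key k

/-- The discrete Euler-Lagrange equation. -/
lemma transpose_mul_isoOp_of_minimal [NeZero n] (hμ : 0 < μ) (hμc : 0 < μc) (hκ : 0 < κ)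
    {A B : Mat n} {N : ℕ} {g : ℕ → Mat n} (hg : chain A g N = B)
    (hmin : ∀ h, chain A h N = B → chainEnergy μ μc κ g N ≤ chainEnergy μ μc κ h N)
    {i : ℕ} (hi : i + 1 < N) :
    (1 + g i)ᵀ * isoOp μ μc κ (g i)
      = isoOp μ μc κ (g (i + 1)) * (1 + g (i + 1))ᵀ := by
  refine eq_of_frobInner_eq fun ζ => ?_
  rw [← frobInner_mul_left, ← frobInner_mul_right, ← isoInner_eq_frobInner,
    ← isoInner_eq_frobInner]
  -- The variation replaces the factors by `(1 + gᵢ) exp(εζ)` and `exp(-εζ) (1 + gᵢ₊₁)`, which keeps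
  -- their product and hence the end point. The derivative of the energy at `ε = 0` must vanish for
  -- every `ζ`.
  set a : ℝ → Mat n := fun ε => (1 + g i) * NormedSpace.exp (ε • ζ) - 1 with ha
  set b : ℝ → Mat n := fun ε => NormedSpace.exp (ε • -ζ) * (1 + g (i + 1)) - 1 with hb
  have ha0 : a 0 = g i := by simp [ha]
  have hb0 : b 0 = g (i + 1) := by simp [hb]
  have hda : HasDerivAt a ((1 + g i) * ζ) 0 := by
    have h1 : HasDerivAt (fun u : ℝ => NormedSpace.exp (u • ζ)) (NormedSpace.exp ((0 : ℝ) • ζ) * ζ) 0 :=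
      hasDerivAt_exp_smul_const ζ 0
    exact ((h1.const_mul (1 + g i)).sub_const 1).congr_deriv (by simp)
  have hdb : HasDerivAt b (-(ζ * (1 + g (i + 1)))) 0 := by
    have h1 : HasDerivAt (fun u : ℝ => NormedSpace.exp (u • -ζ))
        (NormedSpace.exp ((0 : ℝ) • -ζ) * -ζ) 0 := hasDerivAt_exp_smul_const (-ζ) 0
    exact ((h1.mul_const (1 + g (i + 1))).sub_const 1).congr_deriv (by simp)
  have hd := (hasDerivAt_isoInner (μ := μ) (μc := μc) (κ := κ) hda).add
    (hasDerivAt_isoInner (μ := μ) (μc := μc) (κ := κ) hdb)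
  have hloc : IsLocalMin ((fun s => isoInner μ μc κ (a s) (a s)) +
      fun s => isoInner μ μc κ (b s) (b s)) 0 := by
    refine Filter.Eventually.of_forall fun ε => ?_
    have hprod : (1 + a ε) * (1 + b ε) = (1 + g i) * (1 + g (i + 1)) := by
      have h1 : NormedSpace.exp (ε • ζ) * NormedSpace.exp (ε • -ζ) = 1 := by
        rw [smul_neg]
        exact exp_mul_exp_neg (ε • ζ)
      simp only [ha, hb, add_sub_cancel]
      rw [mul_assoc, ← mul_assoc (NormedSpace.exp (ε • ζ)), h1, one_mul]
    have h1 := hmin _ ((chain_update_update A g hi hprod).trans hg)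
    rw [chainEnergy, chainEnergy, sum_range_update hi _ _ (fun M => isoNorm μ μc κ M ^ 2),
      sum_range_update (by omega) _ _ (fun M => isoNorm μ μc κ M ^ 2),
      Function.update_of_ne (by omega)] at h1
    simp only [sq_isoNorm hμ hμc hκ] at h1
    simp only [Pi.add_apply, ha0, hb0]
    linarith
  have h0 := hloc.hasDerivAt_eq_zero hd
  rw [ha0, hb0] at h0
  have hneg : isoInner μ μc κ (g (i + 1)) (-(ζ * (1 + g (i + 1))))
      = - isoInner μ μc κ (g (i + 1)) (ζ * (1 + g (i + 1))) := by
    rw [isoInner_eq_frobInner, isoInner_eq_frobInner]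
    simp [frobInner]
  rw [hneg] at h0
  linarith

end Minimiser

/-! ### Conserved momentum and uniform step size. -/

section StepBounds

lemma norm_mul_one_add_le (M N : Mat n) : ‖M * (1 + N)‖ ≤ ‖M‖ * Real.exp ‖N‖ := by
  rw [mul_add, mul_one]
  calc ‖M + M * N‖ ≤ ‖M‖ + ‖M‖ * ‖N‖ := (norm_add_le _ _).trans (by gcongr; exact norm_mul_le _ _)
    _ = ‖M‖ * (‖N‖ + 1) := by ring
    _ ≤ _ := by gcongr; exact Real.add_one_le_exp _

lemma norm_one_add_mul_le (M N : Mat n) : ‖(1 + N) * M‖ ≤ Real.exp ‖N‖ * ‖M‖ := by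
  rw [add_mul, one_mul]
  calc ‖M + N * M‖ ≤ ‖M‖ + ‖N‖ * ‖M‖ := (norm_add_le _ _).trans (by gcongr; exact norm_mul_le _ _)
    _ = (‖N‖ + 1) * ‖M‖ := by ring
    _ ≤ _ := by gcongr; exact Real.add_one_le_exp _

lemma norm_chain_le (A : Mat n) (g : ℕ → Mat n) (k : ℕ) :
    ‖chain A g k‖ ≤ ‖A‖ * Real.exp (∑ i ∈ Finset.range k, ‖g i‖) := by
  induction k with
  | zero => simp [chain]
  | succ k ih =>
    rw [Finset.sum_range_succ, Real.exp_add, ← mul_assoc]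
    refine (norm_mul_one_add_le _ _).trans ?_
    gcongr

lemma det_chain_ne_zero {A B : Mat n} {g : ℕ → Mat n} {N : ℕ} (hB : B.det ≠ 0)
    (hg : chain A g N = B) {k : ℕ} (hk : k ≤ N) : (chain A g k).det ≠ 0 := by
  induction hk using Nat.decreasingInduction with
  | self => rwa [hg]
  | of_succ k hk ih =>
    intro h
    apply ih
    rw [chain, Matrix.det_mul, h, zero_mul]

lemma inv_chain_eq {A B : Mat n} {g : ℕ → Mat n} {N : ℕ} (hB : B.det ≠ 0)
    (hg : chain A g N = B) {k : ℕ} (hk : k < N) :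
    (chain A g k)⁻¹ = (1 + g k) * (chain A g (k + 1))⁻¹ := by
  have h1 : IsUnit (1 + g k).det := by
    refine isUnit_iff_ne_zero.2 fun h => det_chain_ne_zero hB hg (k := k + 1) hk ?_
    rw [chain, Matrix.det_mul, h, mul_zero]
  rw [chain, Matrix.mul_inv_rev, Matrix.mul_nonsing_inv_cancel_left _ _ h1]

/-- Descending induction from `B` expresses the inverse through the factors `1 + gᵢ` themselves, so
no bound on their inverses is needed. -/
lemma norm_inv_chain_le {A B : Mat n} {g : ℕ → Mat n} {N : ℕ} (hB : B.det ≠ 0)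
    (hg : chain A g N = B) {k : ℕ} (hk : k ≤ N) :
    ‖(chain A g k)⁻¹‖ ≤ Real.exp (∑ i ∈ Finset.Ico k N, ‖g i‖) * ‖B⁻¹‖ := by
  induction hk using Nat.decreasingInduction with
  | self => simp [hg]
  | of_succ k hk ih =>
    rw [inv_chain_eq hB hg hk, Finset.sum_eq_sum_Ico_succ_bot hk, Real.exp_add, mul_assoc]
    refine (norm_one_add_mul_le _ _).trans ?_
    gcongr

/-- The discrete momentum is conserved. -/
lemma momentum_eq {A B : Mat n} {g : ℕ → Mat n} {N : ℕ} (hB : B.det ≠ 0)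
    (hg : chain A g N = B)
    (hEL : ∀ i, i + 1 < N → (1 + g i)ᵀ * isoOp μ μc κ (g i)
      = isoOp μ μc κ (g (i + 1)) * (1 + g (i + 1))ᵀ) {k : ℕ} (hk : k < N) :
    ((chain A g k)⁻¹)ᵀ * isoOp μ μc κ (g k) * (chain A g (k + 1))ᵀ
      = ((chain A g 0)⁻¹)ᵀ * isoOp μ μc κ (g 0) * (chain A g 1)ᵀ := by
  induction k with
  | zero => rfl
  | succ k ih =>
    have h1 : (chain A g (k + 1 + 1))ᵀ = (1 + g (k + 1))ᵀ * (chain A g (k + 1))ᵀ :=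
      Matrix.transpose_mul _ _
    rw [← ih (by omega), h1, inv_chain_eq hB hg (k := k) (by omega), Matrix.transpose_mul]
    calc _ = ((chain A g (k + 1))⁻¹)ᵀ * (isoOp μ μc κ (g (k + 1)) * (1 + g (k + 1))ᵀ)
          * (chain A g (k + 1))ᵀ := by simp only [mul_assoc]
      _ = _ := by rw [← hEL k hk]; simp only [mul_assoc]

/-- Chains of bounded energy that satisfy the discrete Euler-Lagrange equation have steps of size
`O(1 / N)`. -/
lemma exists_step_bound [NeZero n] (hμ : 0 < μ) (hμc : 0 < μc) (hκ : 0 < κ) {A B : Mat n}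
    (hB : B.det ≠ 0) (E : ℝ) :
    ∃ R : ℝ, ∀ (N : ℕ) (g : ℕ → Mat n), chain A g N = B →
      (∀ i, i + 1 < N → (1 + g i)ᵀ * isoOp μ μc κ (g i)
        = isoOp μ μc κ (g (i + 1)) * (1 + g (i + 1))ᵀ) →
      N * chainEnergy μ μc κ g N ≤ E →
      (∀ i ≤ N, ‖chain A g i‖ ≤ R) ∧ ∀ i < N, N * ‖g i‖ ≤ R := by
  obtain ⟨K, hK, hKn⟩ := exists_norm_le_isoNorm (n := n) hμ hμc hκ
  obtain ⟨a, ha, han⟩ := (isoOp (n := n) μ μc κ).bound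
  obtain ⟨b, hb, hbn⟩ := (isoOp (n := n) μ⁻¹ μc⁻¹ κ⁻¹).bound
  set s := K * √E with hs
  have hs0 : 0 ≤ s := by positivity
  set c := (‖A‖ + ‖B⁻¹‖) * Real.exp s with hc
  have hc0 : 0 ≤ c := by positivity
  -- By Cauchy–Schwarz `s` bounds the total step size, and `c` then bounds all nodes and their
  -- inverses. The second entry comes from `N ‖P‖ ≤ c² a s` and `‖g k‖ ≤ b c² ‖P‖`.
  refine ⟨max c (b * c ^ 2 * (c ^ 2 * a * s)), fun N g hg hEL hE => ?_⟩
  have hsum : ∑ i ∈ Finset.range N, ‖g i‖ ≤ s := by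
    calc ∑ i ∈ Finset.range N, ‖g i‖ ≤ ∑ i ∈ Finset.range N, K * isoNorm μ μc κ (g i) :=
          Finset.sum_le_sum fun i _ => hKn _
      _ = K * ∑ i ∈ Finset.range N, isoNorm μ μc κ (g i) := by rw [Finset.mul_sum]
      _ ≤ K * √E := by
        gcongr
        refine Real.le_sqrt_of_sq_le (le_trans ?_ hE)
        have := sq_sum_le_card_mul_sum_sq (s := Finset.range N)
          (f := fun i => isoNorm μ μc κ (g i))
        rwa [Finset.card_range] at this
  have hX : ∀ i ≤ N, ‖chain A g i‖ ≤ c := fun i hi => by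
    refine (norm_chain_le A g i).trans ?_
    have : ∑ i ∈ Finset.range i, ‖g i‖ ≤ s := le_trans
      (Finset.sum_le_sum_of_subset_of_nonneg (Finset.range_mono hi) fun _ _ _ => norm_nonneg _) hsum
    rw [hc]
    gcongr
    linarith [norm_nonneg B⁻¹]
  have hY : ∀ i ≤ N, ‖(chain A g i)⁻¹‖ ≤ c := fun i hi => by
    refine (norm_inv_chain_le hB hg hi).trans ?_
    have : ∑ i ∈ Finset.Ico i N, ‖g i‖ ≤ s := le_trans
      (Finset.sum_le_sum_of_subset_of_nonneg (by
        rw [Finset.range_eq_Ico]; exact Finset.Ico_subset_Ico_left (Nat.zero_le _))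
        fun _ _ _ => norm_nonneg _) hsum
    rw [hc, mul_comm]
    gcongr
    linarith [norm_nonneg A]
  -- The momentum `P` is the same at every step and comparable to each `g k`. Summing `‖P‖ ≤ c² a ‖g
  -- k‖` over `k` makes `P` of order `1 / N`, and then each step as well.
  set P := ((chain A g 0)⁻¹)ᵀ * isoOp μ μc κ (g 0) * (chain A g 1)ᵀ with hP
  have hmom : ∀ k < N, ((chain A g k)⁻¹)ᵀ * isoOp μ μc κ (g k) * (chain A g (k + 1))ᵀ = P :=
    fun k hk => momentum_eq hB hg hEL hk
  have hPle : ∀ k ∈ Finset.range N, ‖P‖ ≤ c ^ 2 * a * ‖g k‖ := fun k hk => by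
    have hk := Finset.mem_range.1 hk
    rw [← hmom k hk]
    calc _ ≤ ‖((chain A g k)⁻¹)ᵀ‖ * ‖isoOp μ μc κ (g k)‖ * ‖(chain A g (k + 1))ᵀ‖ :=
          norm_mul₃_le
      _ ≤ c * (a * ‖g k‖) * c := by
        rw [Matrix.frobenius_norm_transpose, Matrix.frobenius_norm_transpose]
        gcongr
        · exact hY k hk.le
        · exact han _
        · exact hX _ hk
      _ = _ := by ring
  have hNP : N * ‖P‖ ≤ c ^ 2 * a * s := by
    have h1 := Finset.sum_le_sum hPle
    rw [Finset.sum_const, Finset.card_range, nsmul_eq_mul, ← Finset.mul_sum] at h1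
    refine h1.trans ?_
    gcongr
  refine ⟨fun i hi => (hX i hi).trans (le_max_left _ _), fun k hk => le_trans ?_ (le_max_right _ _)⟩
  have hback : isoOp μ μc κ (g k) = (chain A g k)ᵀ * P * ((chain A g (k + 1))⁻¹)ᵀ := by
    have h1 : (chain A g k)ᵀ * ((chain A g k)⁻¹)ᵀ = 1 := by
      rw [← Matrix.transpose_mul, Matrix.nonsing_inv_mul _
        (isUnit_iff_ne_zero.2 (det_chain_ne_zero hB hg hk.le)), Matrix.transpose_one]
    have h2 : (chain A g (k + 1))ᵀ * ((chain A g (k + 1))⁻¹)ᵀ = 1 := by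
      rw [← Matrix.transpose_mul, Matrix.nonsing_inv_mul _
        (isUnit_iff_ne_zero.2 (det_chain_ne_zero hB hg hk)), Matrix.transpose_one]
    rw [← hmom k hk]
    calc _ = 1 * isoOp μ μc κ (g k) * 1 := by rw [one_mul, mul_one]
      _ = ((chain A g k)ᵀ * ((chain A g k)⁻¹)ᵀ) * isoOp μ μc κ (g k) *
          ((chain A g (k + 1))ᵀ * ((chain A g (k + 1))⁻¹)ᵀ) := by rw [h1, h2]
      _ = _ := by simp only [mul_assoc]
  have hgk : ‖g k‖ ≤ b * (c * ‖P‖ * c) := by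
    conv_lhs => rw [← isoOp_left_inv hμ.ne' hμc.ne' hκ.ne' (g k)]
    refine (hbn _).trans ?_
    rw [hback]
    gcongr
    refine norm_mul₃_le.trans ?_
    rw [Matrix.frobenius_norm_transpose, Matrix.frobenius_norm_transpose]
    gcongr
    · exact hX k hk.le
    · exact hY _ hk
  calc N * ‖g k‖ ≤ N * (b * (c * ‖P‖ * c)) := by gcongr
    _ = b * c ^ 2 * (N * ‖P‖) := by ring
    _ ≤ _ := by gcongr

end StepBounds

open Asymptotics Filter

/-! ### Uniform Taylor bounds for the exponential. -/

section Exponential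

lemma exists_norm_exp_le (R : ℝ) : ∃ C, 0 ≤ C ∧ ∀ Z : Mat n, ‖Z‖ ≤ R → ‖NormedSpace.exp Z‖ ≤ C := by
  obtain ⟨C, hC⟩ := (isCompact_closedBall (0 : Mat n) R).exists_bound_of_continuousOn
    (f := fun Z => NormedSpace.exp Z) (NormedSpace.exp_continuous (𝔸 := Mat n)).continuousOn
  exact ⟨max C 0, le_max_right _ _,
    fun Z hZ => (hC Z (mem_closedBall_zero_iff.2 hZ)).trans (le_max_left _ _)⟩

/-- The mean value inequality is applied twice, the first-order bound serving as derivative bound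
for the second-order one. -/
lemma exists_norm_exp_smul_sub_le (R : ℝ) :
    ∃ C, 0 ≤ C ∧ ∀ Z : Mat n, ‖Z‖ ≤ R → ∀ t ∈ Set.Icc (0 : ℝ) 1,
      ‖NormedSpace.exp (t • Z) - 1‖ ≤ C * t ∧
      ‖NormedSpace.exp (t • Z) - 1 - t • Z‖ ≤ C * (t * t) := by
  obtain ⟨C, hC0, hC⟩ := exists_norm_exp_le (n := n) R
  by_cases hR : R < 0
  · exact ⟨0, le_rfl, fun Z hZ => absurd (norm_nonneg Z) (by linarith)⟩
  replace hR := not_lt.1 hR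
  refine ⟨max (C * R) (C * R * R), le_max_of_le_left (by positivity), fun Z hZ => ?_⟩
  have hd : ∀ t : ℝ, HasDerivAt (fun u : ℝ => NormedSpace.exp (u • Z))
      (NormedSpace.exp (t • Z) * Z) t := fun t => hasDerivAt_exp_smul_const Z t
  have h1 : ∀ t ∈ Set.Icc (0 : ℝ) 1, ‖NormedSpace.exp (t • Z) - 1‖ ≤ C * R * t := by
    intro t ht
    have := (convex_Icc (0 : ℝ) 1).norm_image_sub_le_of_norm_hasDerivWithin_le
      (f := fun u : ℝ => NormedSpace.exp (u • Z)) (C := C * R)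
      (fun s _ => (hd s).hasDerivWithinAt) (fun s hs => ?_)
      (Set.left_mem_Icc.2 zero_le_one) ht
    · simpa [abs_of_nonneg ht.1] using this
    · refine (norm_mul_le _ _).trans ?_
      gcongr
      refine hC _ ?_
      rw [norm_smul, Real.norm_eq_abs, abs_of_nonneg hs.1]
      nlinarith [norm_nonneg Z, hs.2]
  intro t ht
  refine ⟨(h1 t ht).trans (mul_le_mul_of_nonneg_right (le_max_left _ _) ht.1), ?_⟩
  have hsub : Set.Icc (0 : ℝ) t ⊆ Set.Icc 0 1 := Set.Icc_subset_Icc_right ht.2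
  have := (convex_Icc (0 : ℝ) t).norm_image_sub_le_of_norm_hasDerivWithin_le
      (f := fun u : ℝ => NormedSpace.exp (u • Z) - 1 - u • Z)
      (f' := fun s => (NormedSpace.exp (s • Z) - 1) * Z) (C := C * R * t * R)
      (fun s _ => ?_) (fun s hs => ?_)
      (Set.left_mem_Icc.2 ht.1) (Set.right_mem_Icc.2 ht.1)
  · simp only [zero_smul, NormedSpace.exp_zero, sub_self, sub_zero, Real.norm_eq_abs,
      abs_of_nonneg ht.1] at this
    calc _ ≤ C * R * t * R * t := this
      _ = C * R * R * (t * t) := by ring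
      _ ≤ _ := mul_le_mul_of_nonneg_right (le_max_right _ _) (mul_self_nonneg _)
  · have h2 : HasDerivAt (fun u : ℝ => u • Z) Z s := by
      simpa using (hasDerivAt_id s).smul_const Z
    refine ((((hd s).sub_const 1).sub h2).congr_deriv ?_).hasDerivWithinAt
    rw [sub_mul, one_mul]
  · refine (norm_mul_le _ _).trans ?_
    gcongr
    · exact mul_nonneg (mul_nonneg hC0 hR) ht.1
    · refine (h1 s (hsub hs)).trans ?_
      gcongr
      exact hs.2

end Exponential

/-! ### Products and linear images under big-O. -/

section BigO

variable {ι : Type*} {l : Filter ι} {f g : ι → Mat n} {k r : ι → ℝ}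

lemma isBigO_bdd_mul (hf : f =O[l] fun _ => (1 : ℝ)) (hg : g =O[l] k) :
    (fun p => f p * g p) =O[l] k := by
  simpa using hf.mul hg

lemma isBigO_mul_bdd (hf : f =O[l] k) (hg : g =O[l] fun _ => (1 : ℝ)) :
    (fun p => f p * g p) =O[l] k := by
  simpa using hf.mul hg

lemma isBigO_real_smul (hf : f =O[l] k) : (fun p => r p • f p) =O[l] fun p => r p * k p :=
  (isBigO_refl r l).smul hf

lemma isBigO_clm (T : Mat n →L[ℝ] Mat n) (hf : f =O[l] k) : (fun p => T (f p)) =O[l] k :=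
  (T.isBigO_comp f l).trans hf

lemma isBigO_transpose (hf : f =O[l] k) : (fun p => (f p)ᵀ) =O[l] k := by
  rw [← isBigO_norm_left] at hf ⊢
  simpa only [Matrix.frobenius_norm_transpose] using hf

end BigO

/-! ### Bounds uniform in the number of steps and the position. -/

section Mesh

/-- Pairs `(N, i)` with `N ≥ N₀`, `N ≥ 1` and `i + k ≤ N`. -/
def meshSet (N₀ k : ℕ) : Set (ℕ × ℕ) := {p | N₀ ≤ p.1 ∧ 0 < p.1 ∧ p.2 + k ≤ p.1}

/-- The mesh size `1 / N`. -/
noncomputable def mesh (p : ℕ × ℕ) : ℝ := (p.1 : ℝ)⁻¹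

lemma meshSet_anti {N₀ k l : ℕ} (h : k ≤ l) : meshSet N₀ l ⊆ meshSet N₀ k :=
  fun _ hp => ⟨hp.1, hp.2.1, le_trans (by omega) hp.2.2⟩

lemma mesh_nonneg (p : ℕ × ℕ) : 0 ≤ mesh p := by unfold mesh; positivity

lemma mesh_le_one (p : ℕ × ℕ) : mesh p ≤ 1 := Nat.cast_inv_le_one _

lemma natCast_mul_mesh_le {N₀ k : ℕ} {p : ℕ × ℕ} (hp : p ∈ meshSet N₀ k) : p.2 * mesh p ≤ 1 := by
  have h1 : (0 : ℝ) < p.1 := by exact_mod_cast hp.2.1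
  have h2 : (p.2 : ℝ) ≤ p.1 := by exact_mod_cast le_trans (Nat.le_add_right _ _) hp.2.2
  rw [mesh, ← div_eq_mul_inv, div_le_one h1]
  exact h2

/-- At most `N` increments of size `O(1/N²)` add up to `O(1/N)`. Along a principal filter big-O is a
single constant valid on the whole set. The hypothesis lives on the smaller set with `k + 1` because
it also uses index `i + 1`. -/
lemma isBigO_telescope {N₀ k : ℕ} {f : ℕ × ℕ → Mat n}
    (h : (fun p => f (p.1, p.2 + 1) - f p) =O[𝓟 (meshSet N₀ (k + 1))] fun p => mesh p * mesh p) :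
    (fun p => f p - f (p.1, 0)) =O[𝓟 (meshSet N₀ k)] mesh := by
  rw [isBigO_principal] at h ⊢
  obtain ⟨C, hC⟩ := h
  refine ⟨|C|, fun p hp => ?_⟩
  have key : ∀ i : ℕ, i + k ≤ p.1 → ‖f (p.1, i) - f (p.1, 0)‖ ≤ i * (|C| * (mesh p * mesh p)) := by
    intro i
    induction i with
    | zero => simp
    | succ i ih =>
      intro hi
      have h1 := hC (p.1, i) ⟨hp.1, hp.2.1, by simp only; omega⟩
      have h2 := ih (by omega)
      have h3 : C * ‖mesh (p.1, i) * mesh (p.1, i)‖ ≤ |C| * (mesh p * mesh p) := by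
        rw [Real.norm_of_nonneg (mul_self_nonneg _)]
        exact mul_le_mul_of_nonneg_right (le_abs_self C) (mul_self_nonneg _)
      calc ‖f (p.1, i + 1) - f (p.1, 0)‖
          = ‖(f (p.1, i + 1) - f (p.1, i)) + (f (p.1, i) - f (p.1, 0))‖ := by congr 1; abel
        _ ≤ |C| * (mesh p * mesh p) + i * (|C| * (mesh p * mesh p)) :=
          (norm_add_le _ _).trans (add_le_add (h1.trans h3) h2)
        _ = _ := by push_cast; ring
  refine (key p.2 hp.2.2).trans ?_
  rw [Real.norm_of_nonneg (mesh_nonneg p)]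
  calc p.2 * (|C| * (mesh p * mesh p)) = (p.2 * mesh p) * (|C| * mesh p) := by ring
    _ ≤ 1 * (|C| * mesh p) := by
      gcongr
      · exact mul_nonneg (abs_nonneg _) (mesh_nonneg p)
      · exact natCast_mul_mesh_le hp
    _ = _ := one_mul _

lemma isBigO_exp_smul {N₀ k : ℕ} {z : ℕ × ℕ → Mat n} {t : ℕ × ℕ → ℝ}
    (hz : z =O[𝓟 (meshSet N₀ k)] fun _ => (1 : ℝ)) (ht : ∀ p ∈ meshSet N₀ k, |t p| ≤ 1) :
    (fun p => NormedSpace.exp (t p • z p)) =O[𝓟 (meshSet N₀ k)] fun _ => (1 : ℝ) := by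
  rw [isBigO_principal] at hz ⊢
  obtain ⟨R, hR⟩ := hz
  obtain ⟨C, -, hC⟩ := exists_norm_exp_le (n := n) R
  refine ⟨C, fun p hp => ?_⟩
  simp only [norm_one, mul_one] at hR ⊢
  refine hC _ ?_
  rw [norm_smul, Real.norm_eq_abs]
  exact (mul_le_of_le_one_left (norm_nonneg _) (ht p hp)).trans (hR p hp)

lemma isBigO_exp_mesh_smul {N₀ k : ℕ} {z : ℕ × ℕ → Mat n}
    (hz : z =O[𝓟 (meshSet N₀ k)] fun _ => (1 : ℝ)) :
    ((fun p => NormedSpace.exp (mesh p • z p) - 1) =O[𝓟 (meshSet N₀ k)] mesh) ∧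
    (fun p => NormedSpace.exp (mesh p • z p) - 1 - mesh p • z p) =O[𝓟 (meshSet N₀ k)]
      fun p => mesh p * mesh p := by
  simp only [isBigO_principal] at hz ⊢
  obtain ⟨R, hR⟩ := hz
  simp only [norm_one, mul_one] at hR
  obtain ⟨C, -, hC⟩ := exists_norm_exp_smul_sub_le (n := n) R
  refine ⟨⟨C, fun p hp => ?_⟩, ⟨C, fun p hp => ?_⟩⟩
  · rw [Real.norm_of_nonneg (mesh_nonneg p)]
    exact (hC _ (hR p hp) _ ⟨mesh_nonneg p, mesh_le_one p⟩).1
  · rw [Real.norm_of_nonneg (mul_self_nonneg _)]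
    exact (hC _ (hR p hp) _ ⟨mesh_nonneg p, mesh_le_one p⟩).2

end Mesh

/-! ### The commutator in the geodesic equation. -/

section Algebra

/-- With `M = S + W`, the commutator `[M, W] = [S, W]` is symmetric and trace-free, so the operator
multiplies it by `μ`. The right-hand side is `[S - W, μ S + μc W] = (μ + μc)[S, W]`. -/
lemma isoOp_commutator [NeZero n] (hμ : 0 < μ) (M : Mat n) :
    isoOp μ μc κ ((1 + μc / μ) • (M * skewPart M - skewPart M * M))
      = Mᵀ * isoOp μ μc κ M - isoOp μ μc κ M * Mᵀ := by
  have hM : M = symPart M + skewPart M := (symPart_add_skewPart M).symm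
  have hMt : Mᵀ = symPart M - skewPart M := by
    conv_lhs => rw [hM]
    rw [Matrix.transpose_add, transpose_symPart, transpose_skewPart, sub_eq_add_neg]
  set S := symPart M with hS
  set W := skewPart M with hW
  have hSt : Sᵀ = S := transpose_symPart M
  have hWt : Wᵀ = -W := transpose_skewPart M
  have hcomm : M * W - W * M = S * W - W * S := by
    conv_lhs => rw [hM]
    noncomm_ring
  have hsym : symPart ((1 + μc / μ) • (S * W - W * S)) = (1 + μc / μ) • (S * W - W * S) := by
    simp only [symPart, Matrix.transpose_smul, Matrix.transpose_sub, Matrix.transpose_mul, hSt, hWt]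
    rw [neg_mul, mul_neg]
    module
  have hskew : skewPart ((1 + μc / μ) • (S * W - W * S)) = 0 := by
    simp only [skewPart, Matrix.transpose_smul, Matrix.transpose_sub, Matrix.transpose_mul, hSt,
      hWt]
    rw [neg_mul, mul_neg]
    module
  have htr : ((1 + μc / μ) • (S * W - W * S)).trace = 0 := by
    rw [Matrix.trace_smul, Matrix.trace_sub, Matrix.trace_mul_comm, sub_self, smul_zero]
  rw [hcomm, isoOp_eq, hsym, hskew, htr, isoOp_eq, hMt, ← hS, ← hW]
  simp only [mul_add, add_mul, sub_mul, mul_sub, mul_smul_comm, smul_mul_assoc, mul_one, one_mul,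
    smul_sub, smul_smul, smul_zero, zero_div, mul_zero, zero_smul]
  rw [show μ * (μc / μ) = μc by field_simp]
  module

/-- The skew-symmetric part as a continuous linear map. -/
noncomputable def skewCLM : Mat n →L[ℝ] Mat n :=
  LinearMap.toContinuousLinearMap
    { toFun := skewPart
      map_add' := fun M N => by simp only [skewPart, Matrix.transpose_add]; module
      map_smul' := fun r M => by simp only [skewPart, Matrix.transpose_smul, RingHom.id_apply]; module }

lemma skewCLM_apply (M : Mat n) : skewCLM M = skewPart M := rfl

/-- The commutator of a symmetric and a skew matrix is symmetric. Hence the geodesic equation leaves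
the spin constant. -/
lemma skewPart_commutator (M : Mat n) : skewPart (M * skewPart M - skewPart M * M) = 0 := by
  have hM : M = symPart M + skewPart M := (symPart_add_skewPart M).symm
  have hcomm : M * skewPart M - skewPart M * M
      = symPart M * skewPart M - skewPart M * symPart M := by
    conv_lhs => rw [show M * skewPart M - skewPart M * M = (symPart M + skewPart M) * skewPart M
      - skewPart M * (symPart M + skewPart M) by rw [← hM]]
    noncomm_ring
  rw [hcomm]
  simp only [skewPart.eq_1 (_ - _), Matrix.transpose_sub, Matrix.transpose_mul,
    transpose_symPart, transpose_skewPart]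
  rw [neg_mul, mul_neg]
  module

end Algebra

/-! ### Convergence of discrete geodesics to explicit ones. -/

section Asymptotics

variable {N₀ : ℕ} {V X : ℕ → ℕ → Mat n} {A : Mat n}

lemma isBigO_shift {f : ℕ × ℕ → Mat n} {k : ℕ}
    (hf : f =O[𝓟 (meshSet N₀ k)] fun _ => (1 : ℝ)) :
    (fun p : ℕ × ℕ => f (p.1, p.2 + 1)) =O[𝓟 (meshSet N₀ (k + 1))] fun _ => (1 : ℝ) := by
  rw [isBigO_principal] at hf ⊢
  obtain ⟨C, hC⟩ := hf
  exact ⟨C, fun p hp => hC (p.1, p.2 + 1) ⟨hp.1, hp.2.1, by have := hp.2.2; simp only; omega⟩⟩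

lemma isBigO_initial (hV : (fun p : ℕ × ℕ => V p.1 p.2) =O[𝓟 (meshSet N₀ 1)] fun _ => (1 : ℝ))
    (k : ℕ) : (fun p : ℕ × ℕ => V p.1 0) =O[𝓟 (meshSet N₀ k)] fun _ => (1 : ℝ) := by
  rw [isBigO_principal] at hV ⊢
  obtain ⟨C, hC⟩ := hV
  exact ⟨C, fun p hp => hC (p.1, 0) ⟨hp.1, hp.2.1, by have := hp.2.1; simp only; omega⟩⟩

/-- Velocities solving the discrete Euler-Lagrange equation follow the equation
`V' = (1 + ω) [V, skew V]` up to second order. -/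
lemma isBigO_velocity_step [NeZero n] (hμ : 0 < μ) (hμc : 0 < μc) (hκ : 0 < κ)
    (hV : (fun p : ℕ × ℕ => V p.1 p.2) =O[𝓟 (meshSet N₀ 1)] fun _ => (1 : ℝ))
    (hEL : ∀ p ∈ meshSet N₀ 2, (1 + mesh p • V p.1 p.2)ᵀ * isoOp μ μc κ (V p.1 p.2)
      = isoOp μ μc κ (V p.1 (p.2 + 1)) * (1 + mesh p • V p.1 (p.2 + 1))ᵀ) :
    ((fun p : ℕ × ℕ => V p.1 (p.2 + 1) - V p.1 p.2) =O[𝓟 (meshSet N₀ 2)] mesh) ∧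
    (fun p : ℕ × ℕ => V p.1 (p.2 + 1) - V p.1 p.2 - mesh p • ((1 + μc / μ) •
      (V p.1 p.2 * skewPart (V p.1 p.2) - skewPart (V p.1 p.2) * V p.1 p.2)))
      =O[𝓟 (meshSet N₀ 2)] fun p => mesh p * mesh p := by
  have hv : (fun p : ℕ × ℕ => V p.1 p.2) =O[𝓟 (meshSet N₀ 2)] fun _ => (1 : ℝ) :=
    hV.mono (principal_mono.2 (meshSet_anti (by norm_num)))
  have hv' : (fun p : ℕ × ℕ => V p.1 (p.2 + 1)) =O[𝓟 (meshSet N₀ 2)] fun _ => (1 : ℝ) :=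
    isBigO_shift hV
  set I : Mat n →L[ℝ] Mat n := isoOp μ μc κ with hI
  have hIinv : ∀ M : Mat n, isoOp μ⁻¹ μc⁻¹ κ⁻¹ (I M) = M :=
    isoOp_left_inv hμ.ne' hμc.ne' hκ.ne'
  have heq : ∀ p ∈ meshSet N₀ 2, I (V p.1 (p.2 + 1) - V p.1 p.2) = mesh p •
      ((V p.1 p.2)ᵀ * I (V p.1 p.2) - I (V p.1 (p.2 + 1)) * (V p.1 (p.2 + 1))ᵀ) := by
    intro p hp
    have h := hEL p hp
    rw [Matrix.transpose_add, Matrix.transpose_add, Matrix.transpose_one, Matrix.transpose_smul,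
      Matrix.transpose_smul, add_mul, mul_add, one_mul, mul_one, smul_mul_assoc,
      mul_smul_comm] at h
    rw [map_sub, smul_sub, sub_eq_sub_iff_add_eq_add, ← h]
    abel
  have h1 : (fun p : ℕ × ℕ => I (V p.1 (p.2 + 1) - V p.1 p.2)) =O[𝓟 (meshSet N₀ 2)] mesh := by
    have h2 := isBigO_real_smul (r := mesh) ((isBigO_bdd_mul (isBigO_transpose hv)
      (isBigO_clm I hv)).sub (isBigO_bdd_mul (isBigO_clm I hv') (isBigO_transpose hv')))
    simp only [mul_one] at h2
    exact h2.congr' (eventually_principal.2 fun p hp => (heq p hp).symm) EventuallyEq.rfl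
  have h2 : (fun p : ℕ × ℕ => V p.1 (p.2 + 1) - V p.1 p.2) =O[𝓟 (meshSet N₀ 2)] mesh := by
    simpa only [hIinv] using isBigO_clm (isoOp μ⁻¹ μc⁻¹ κ⁻¹) h1
  refine ⟨h2, ?_⟩
  have h3 : (fun p : ℕ × ℕ => I (V p.1 (p.2 + 1) - V p.1 p.2 - mesh p • ((1 + μc / μ) •
      (V p.1 p.2 * skewPart (V p.1 p.2) - skewPart (V p.1 p.2) * V p.1 p.2))))
      =O[𝓟 (meshSet N₀ 2)] fun p => mesh p * mesh p := by
    -- Replacing `Vᵢ₊₁` by `Vᵢ` in the quadratic term leaves `I(d) Vᵢᵀ + I(Vᵢ₊₁) dᵀ` with `d = Vᵢ₊₁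
    -- - Vᵢ`, which gains a second factor of the mesh.
    have h4 := (isBigO_real_smul (r := mesh) ((isBigO_mul_bdd (isBigO_clm I h2)
      (isBigO_transpose hv)).add (isBigO_bdd_mul (isBigO_clm I hv') (isBigO_transpose h2)))).neg_left
    refine h4.congr' (eventually_principal.2 fun p hp => ?_) EventuallyEq.rfl
    have h5 : I (V p.1 (p.2 + 1) - V p.1 p.2) * (V p.1 p.2)ᵀ
        = I (V p.1 (p.2 + 1)) * (V p.1 p.2)ᵀ - I (V p.1 p.2) * (V p.1 p.2)ᵀ := by
      rw [map_sub, sub_mul]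
    dsimp only
    rw [h5, map_sub I (V p.1 (p.2 + 1) - V p.1 p.2), heq p hp, map_smul, hI, isoOp_commutator hμ,
      ← hI, ← smul_sub, ← smul_neg, Matrix.transpose_sub]
    congr 1
    noncomm_ring
  simpa only [hIinv] using isBigO_clm (isoOp μ⁻¹ μc⁻¹ κ⁻¹) h3

lemma exp_succ_smul (c : ℝ) (i : ℕ) (Z : Mat n) :
    NormedSpace.exp (((i + 1 : ℕ) * c) • Z)
      = NormedSpace.exp ((i * c) • Z) * NormedSpace.exp (c • Z) := by
  have h : ((i + 1 : ℕ) * c) • Z = (i * c) • Z + c • Z := by push_cast; module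
  rw [h]
  exact Matrix.exp_add_of_commute _ _ (((Commute.refl Z).smul_right c).smul_left _)

lemma exp_succ_smul' (c : ℝ) (i : ℕ) (Z : Mat n) :
    NormedSpace.exp (((i + 1 : ℕ) * c) • Z)
      = NormedSpace.exp (c • Z) * NormedSpace.exp ((i * c) • Z) := by
  have h : ((i + 1 : ℕ) * c) • Z = c • Z + (i * c) • Z := by push_cast; module
  rw [h]
  exact Matrix.exp_add_of_commute _ _ (((Commute.refl Z).smul_right _).smul_left _)

lemma exp_smul_mul_exp_smul_neg (c : ℝ) (Z : Mat n) :
    NormedSpace.exp (c • Z) * NormedSpace.exp (c • -Z) = 1 := by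
  rw [smul_neg]
  exact exp_mul_exp_neg _

lemma exp_smul_neg_mul_exp_smul (c : ℝ) (Z : Mat n) :
    NormedSpace.exp (c • -Z) * NormedSpace.exp (c • Z) = 1 := by
  rw [smul_neg]
  exact exp_neg_mul_exp _

/-- In the frame rotating with the initial spin the discrete velocity is nearly constant. -/
lemma isBigO_rotated_velocity [NeZero n] (hμ : 0 < μ) (hμc : 0 < μc) (hκ : 0 < κ)
    (hV : (fun p : ℕ × ℕ => V p.1 p.2) =O[𝓟 (meshSet N₀ 1)] fun _ => (1 : ℝ))
    (hEL : ∀ p ∈ meshSet N₀ 2, (1 + mesh p • V p.1 p.2)ᵀ * isoOp μ μc κ (V p.1 p.2)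
      = isoOp μ μc κ (V p.1 (p.2 + 1)) * (1 + mesh p • V p.1 (p.2 + 1))ᵀ)
    {Z : ℕ → Mat n} (hZ : ∀ N, Z N = (1 + μc / μ) • skewPart (V N 0)) :
    (fun p : ℕ × ℕ => NormedSpace.exp ((p.2 * mesh p) • Z p.1) * V p.1 p.2
      * NormedSpace.exp ((p.2 * mesh p) • -Z p.1) - V p.1 0) =O[𝓟 (meshSet N₀ 1)] mesh := by
  obtain ⟨hd1, hd2⟩ := isBigO_velocity_step hμ hμc hκ hV hEL
  have hv : (fun p : ℕ × ℕ => V p.1 p.2) =O[𝓟 (meshSet N₀ 2)] fun _ => (1 : ℝ) :=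
    hV.mono (principal_mono.2 (meshSet_anti (by norm_num)))
  have hv' : (fun p : ℕ × ℕ => V p.1 (p.2 + 1)) =O[𝓟 (meshSet N₀ 2)] fun _ => (1 : ℝ) :=
    isBigO_shift hV
  have hz : (fun p : ℕ × ℕ => Z p.1) =O[𝓟 (meshSet N₀ 2)] fun _ => (1 : ℝ) := by
    simp only [hZ]
    exact (isBigO_clm skewCLM (isBigO_initial hV 2)).const_smul_left (1 + μc / μ)
  -- The commutator has no skew part, so the spin changes by `O(1/N²)` per step and stays within
  -- `O(1/N)` of its initial value. This allows the fixed `Z` in place of the current spin.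
  have hw : (fun p : ℕ × ℕ => skewPart (V p.1 p.2) - skewPart (V p.1 0))
      =O[𝓟 (meshSet N₀ 1)] mesh := by
    refine isBigO_telescope (f := fun p => skewPart (V p.1 p.2)) ?_
    have h := isBigO_clm skewCLM hd2
    refine h.congr_left fun p => ?_
    rw [map_sub, map_sub, map_smul, map_smul, skewCLM_apply, skewCLM_apply, skewCLM_apply,
      skewPart_commutator, smul_zero, smul_zero, sub_zero]
  have hw2 := hw.mono (principal_mono.2 (meshSet_anti (N₀ := N₀) (show 1 ≤ 2 by norm_num)))
  have hd3 : (fun p : ℕ × ℕ => V p.1 (p.2 + 1) - V p.1 p.2 - mesh p • (V p.1 p.2 * Z p.1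
      - Z p.1 * V p.1 p.2)) =O[𝓟 (meshSet N₀ 2)] fun p => mesh p * mesh p := by
    have h := hd2.add (isBigO_real_smul (r := mesh)
      (((isBigO_bdd_mul hv hw2).sub (isBigO_mul_bdd hw2 hv)).const_smul_left (1 + μc / μ)))
    refine h.congr_left fun p => ?_
    simp only [hZ, Pi.smul_apply, mul_smul_comm, smul_mul_assoc, mul_sub, sub_mul]
    module
  have hmesh : ∀ p ∈ meshSet N₀ 2, |(p.2 : ℝ) * mesh p| ≤ 1 := fun p hp => by
    rw [abs_of_nonneg (mul_nonneg (Nat.cast_nonneg _) (mesh_nonneg p))]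
    exact natCast_mul_mesh_le hp
  have hQ := isBigO_exp_smul hz hmesh
  have hQi := isBigO_exp_smul hz.neg_left hmesh
  have hri : (fun p : ℕ × ℕ => NormedSpace.exp (mesh p • -Z p.1)) =O[𝓟 (meshSet N₀ 2)]
      fun _ => (1 : ℝ) := isBigO_exp_smul hz.neg_left fun p _ => by
    rw [abs_of_nonneg (mesh_nonneg p)]
    exact mesh_le_one p
  have hr := (isBigO_exp_mesh_smul hz).2
  have hstep : (fun p : ℕ × ℕ => NormedSpace.exp (mesh p • Z p.1) * V p.1 (p.2 + 1)
      - V p.1 p.2 * NormedSpace.exp (mesh p • Z p.1)) =O[𝓟 (meshSet N₀ 2)]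
      fun p => mesh p * mesh p := by
    -- With `h` the mesh, `r = exp(hZ) - 1 - hZ` and `V'` the next velocity, the difference is `r V'
    -- - V r + (V' - V - h[V, Z]) + h Z (V' - V)`.
    have h := (((isBigO_mul_bdd hr hv').sub (isBigO_bdd_mul hv hr)).add hd3).add
      (isBigO_real_smul (r := mesh) (isBigO_bdd_mul hz hd1))
    refine h.congr_left fun p => ?_
    simp only [mul_smul_comm, smul_mul_assoc, mul_sub, sub_mul, mul_one, one_mul]
    module
  have htel := isBigO_telescope (N₀ := N₀) (k := 1)
    (f := fun p : ℕ × ℕ => NormedSpace.exp ((p.2 * mesh p) • Z p.1) * V p.1 p.2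
      * NormedSpace.exp ((p.2 * mesh p) • -Z p.1)) (by
    refine (isBigO_mul_bdd (isBigO_mul_bdd (isBigO_bdd_mul hQ hstep) hri) hQi).congr_left
      fun p => ?_
    have h1 : mesh (p.1, p.2 + 1) = mesh p := rfl
    dsimp only
    rw [h1, exp_succ_smul, exp_succ_smul', mul_sub, sub_mul, sub_mul]
    congr 1
    · simp only [mul_assoc]
    · calc _ = NormedSpace.exp ((p.2 * mesh p) • Z p.1) * V p.1 p.2 *
            (NormedSpace.exp (mesh p • Z p.1) * NormedSpace.exp (mesh p • -Z p.1)) *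
            NormedSpace.exp ((p.2 * mesh p) • -Z p.1) := by simp only [mul_assoc]
        _ = _ := by rw [exp_smul_mul_exp_smul_neg, mul_one])
  refine htel.congr_left fun p => ?_
  simp

/-- Discrete geodesics converge to explicit ones. -/
lemma isBigO_position [NeZero n] (hμ : 0 < μ) (hμc : 0 < μc) (hκ : 0 < κ)
    (hV : (fun p : ℕ × ℕ => V p.1 p.2) =O[𝓟 (meshSet N₀ 1)] fun _ => (1 : ℝ))
    (hEL : ∀ p ∈ meshSet N₀ 2, (1 + mesh p • V p.1 p.2)ᵀ * isoOp μ μc κ (V p.1 p.2)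
      = isoOp μ μc κ (V p.1 (p.2 + 1)) * (1 + mesh p • V p.1 (p.2 + 1))ᵀ)
    {Z : ℕ → Mat n} (hZ : ∀ N, Z N = (1 + μc / μ) • skewPart (V N 0))
    (hX : (fun p : ℕ × ℕ => X p.1 p.2) =O[𝓟 (meshSet N₀ 0)] fun _ => (1 : ℝ))
    (hX0 : ∀ N, X N 0 = A)
    (hXs : ∀ p ∈ meshSet N₀ 1, X p.1 (p.2 + 1) = X p.1 p.2 * (1 + mesh p • V p.1 p.2)) :
    (fun p : ℕ × ℕ => X p.1 p.2 * NormedSpace.exp ((p.2 * mesh p) • -Z p.1)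
      * NormedSpace.exp ((p.2 * mesh p) • -(V p.1 0 - Z p.1)) - A) =O[𝓟 (meshSet N₀ 0)] mesh := by
  have hrot := isBigO_rotated_velocity hμ hμc hκ hV hEL hZ
  have hz : (fun p : ℕ × ℕ => Z p.1) =O[𝓟 (meshSet N₀ 1)] fun _ => (1 : ℝ) := by
    simp only [hZ]
    exact (isBigO_clm skewCLM (isBigO_initial hV 1)).const_smul_left (1 + μc / μ)
  have hv0 := isBigO_initial hV 1
  have hy := hv0.sub hz
  have hmesh : ∀ p ∈ meshSet N₀ 1, |(p.2 : ℝ) * mesh p| ≤ 1 := fun p hp => by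
    rw [abs_of_nonneg (mul_nonneg (Nat.cast_nonneg _) (mesh_nonneg p))]
    exact natCast_mul_mesh_le hp
  have hmesh1 : ∀ p ∈ meshSet N₀ 1, |mesh p| ≤ 1 := fun p hp => by
    rw [abs_of_nonneg (mesh_nonneg p)]
    exact mesh_le_one p
  have hQ := isBigO_exp_smul hz hmesh
  have hQi := isBigO_exp_smul hz.neg_left hmesh
  have hD := isBigO_exp_smul hy.neg_left hmesh
  have hei := isBigO_exp_smul hy.neg_left hmesh1
  obtain ⟨hr1, hr2⟩ := isBigO_exp_mesh_smul hz.neg_left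
  have he := (isBigO_exp_mesh_smul hy).2
  have hx := hX.mono (principal_mono.2 (meshSet_anti (N₀ := N₀) (show 0 ≤ 1 by norm_num)))
  have hvt := isBigO_mul_bdd (isBigO_bdd_mul hQ hV) hQi
  -- One step in the rotating frame: to second order both sides are `1 + h (V₀ - Z)`, as the rotated
  -- velocity is within `O(h)` of `V₀`.
  have hinner : (fun p : ℕ × ℕ => (1 + mesh p • (NormedSpace.exp ((p.2 * mesh p) • Z p.1) * V p.1 p.2
      * NormedSpace.exp ((p.2 * mesh p) • -Z p.1))) * NormedSpace.exp (mesh p • -Z p.1)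
      - NormedSpace.exp (mesh p • (V p.1 0 - Z p.1))) =O[𝓟 (meshSet N₀ 1)]
      fun p => mesh p * mesh p := by
    have h := ((hr2.sub he).add (isBigO_real_smul (r := mesh) (isBigO_bdd_mul hvt hr1))).add
      (isBigO_real_smul (r := mesh) hrot)
    refine h.congr_left fun p => ?_
    simp only [mul_sub, add_mul, one_mul, mul_one, smul_mul_assoc]
    module
  have htel := isBigO_telescope (N₀ := N₀) (k := 0)
    (f := fun p : ℕ × ℕ => X p.1 p.2 * NormedSpace.exp ((p.2 * mesh p) • -Z p.1)
      * NormedSpace.exp ((p.2 * mesh p) • -(V p.1 0 - Z p.1))) (by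
    refine (isBigO_mul_bdd (isBigO_mul_bdd (isBigO_bdd_mul (isBigO_bdd_mul hx hQi) hinner) hei)
      hD).congr' (eventually_principal.2 fun p hp => ?_) EventuallyEq.rfl
    have h1 : mesh (p.1, p.2 + 1) = mesh p := rfl
    dsimp only
    rw [h1, hXs p hp, exp_succ_smul' _ _ (-(V p.1 0 - Z p.1)), mul_sub, sub_mul, sub_mul]
    have h2 := exp_smul_neg_mul_exp_smul (p.2 * mesh p) (Z p.1)
    have h3 := exp_smul_mul_exp_smul_neg (mesh p) (V p.1 0 - Z p.1)
    congr 1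
    · rw [exp_succ_smul _ _ (-Z p.1)]
      set Q := NormedSpace.exp ((p.2 * mesh p) • Z p.1)
      set Qi := NormedSpace.exp ((p.2 * mesh p) • -Z p.1)
      have h4 : Qi * (1 + mesh p • (Q * V p.1 p.2 * Qi)) = (1 + mesh p • V p.1 p.2) * Qi := by
        rw [mul_add, add_mul, mul_one, one_mul, mul_smul_comm, smul_mul_assoc, ← mul_assoc,
          ← mul_assoc, h2, one_mul]
      calc _ = X p.1 p.2 * (Qi * (1 + mesh p • (Q * V p.1 p.2 * Qi))) *
            NormedSpace.exp (mesh p • -Z p.1) * NormedSpace.exp (mesh p • -(V p.1 0 - Z p.1)) *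
            NormedSpace.exp ((p.2 * mesh p) • -(V p.1 0 - Z p.1)) := by simp only [mul_assoc]
        _ = _ := by rw [h4]; simp only [mul_assoc]
    · calc _ = X p.1 p.2 * NormedSpace.exp ((p.2 * mesh p) • -Z p.1) *
            (NormedSpace.exp (mesh p • (V p.1 0 - Z p.1)) *
              NormedSpace.exp (mesh p • -(V p.1 0 - Z p.1))) *
            NormedSpace.exp ((p.2 * mesh p) • -(V p.1 0 - Z p.1)) := by simp only [mul_assoc]
        _ = _ := by rw [h3, mul_one])
  refine htel.congr_left fun p => ?_
  simp [hX0]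

end Asymptotics

/-! ### Passage to the limit. -/

section Existence

lemma isoNorm_rotated (t ω : ℝ) (M W : Mat n) :
    isoNorm μ μc κ (NormedSpace.exp (t • ((1 + ω) • skewPart W)) * M
      * NormedSpace.exp (t • -((1 + ω) • skewPart W))) = isoNorm μ μc κ M := by
  have h1 : t • -((1 + ω) • skewPart W) = (-(t * (1 + ω))) • skewPart W := by module
  have h2 : t • ((1 + ω) • skewPart W) = -((-(t * (1 + ω))) • skewPart W) := by module
  have h3 : (NormedSpace.exp ((-(t * (1 + ω))) • skewPart W))ᵀ
      = NormedSpace.exp (-((-(t * (1 + ω))) • skewPart W)) := transpose_exp_smul_skewPart _ _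
  rw [h1, h2, ← h3]
  exact isoNorm_conj (exp_smul_skewPart_mul_transpose _ _) M

/-- The energy of a discretised curve. -/
lemma exists_chain_energy_le [NeZero n] (hμ : 0 < μ) (hμc : 0 < μc) (hκ : 0 < κ)
    {X : ℝ → Mat n} {a b : ℝ} (h : IsRectifiableCurve X a b) {c : ℝ} (hc : 0 < c)
    (hmul : ∀ M N : Mat n, isoNorm μ μc κ (M * N) ≤ c * isoNorm μ μc κ M * isoNorm μ μc κ N)
    {l : ℝ} (hl : ∫ τ in a..b, isoNorm μ μc κ ((X τ)⁻¹ * deriv X τ) = l) {N : ℕ}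
    (hN : 0 < N) (hlN : c * (l / N) < 1) :
    ∃ g : ℕ → Mat n, chain (X a) g N = X b ∧
      N * chainEnergy μ μc κ g N ≤ (l / (1 - c * (l / N))) ^ 2 := by
  obtain ⟨g, hg, hle⟩ := h.exists_chain hμ hμc hκ hc hmul hl hN hlN
  have hN' : (0 : ℝ) < N := by exact_mod_cast hN
  refine ⟨g, hg, ?_⟩
  calc N * chainEnergy μ μc κ g N
      ≤ N * ∑ i ∈ Finset.range N, ((l / N) / (1 - c * (l / N))) ^ 2 := by
        unfold chainEnergy
        gcongr with i hi
        · exact isoNorm_nonneg _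
        · exact hle i (Finset.mem_range.1 hi)
    _ = (l / (1 - c * (l / N))) ^ 2 := by
        rw [Finset.sum_const, Finset.card_range, nsmul_eq_mul]
        have : 1 - c * (l / N) ≠ 0 := by linarith
        field_simp

/-- Not all steps can exceed the quadratic mean. One good step suffices, since all rotated
velocities nearly agree. -/
lemma exists_isoNorm_le_of_energy_le {g : ℕ → Mat n} {N : ℕ} (hN : 0 < N) {l : ℝ} (hl : 0 ≤ l)
    (h : N * chainEnergy μ μc κ g N ≤ l ^ 2) : ∃ i < N, N * isoNorm μ μc κ (g i) ≤ l := by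
  have hN' : (0 : ℝ) < N := by exact_mod_cast hN
  by_contra! hcon
  have h1 : ∀ i ∈ Finset.range N, l ^ 2 < (N * isoNorm μ μc κ (g i)) ^ 2 := fun i hi =>
    pow_lt_pow_left₀ (hcon i (Finset.mem_range.1 hi)) hl two_ne_zero
  have h2 := Finset.sum_lt_sum_of_nonempty (Finset.nonempty_range_iff.2 hN.ne') h1
  simp only [mul_pow, ← Finset.mul_sum] at h2
  rw [Finset.sum_const, Finset.card_range, nsmul_eq_mul, sq (N : ℝ), mul_assoc] at h2
  exact absurd (lt_of_mul_lt_mul_left h2 hN'.le) (not_lt.2 h)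

/-- Some explicit geodesic is at most as long as every curve with the same end points. -/
theorem exists_solution_le_length [NeZero n] (hμ : 0 < μ) (hμc : 0 < μc) (hκ : 0 < κ)
    {A B : Mat n} (hA : 0 < A.det) (hB : 0 < B.det) :
    ∃ M ∈ geodSolutions (μc / μ) A B, ∀ (X : ℝ → Mat n) (a b : ℝ), IsRectifiableCurve X a b →
      X a = A → X b = B →
      isoNorm μ μc κ M ≤ ∫ τ in a..b, isoNorm μ μc κ ((X τ)⁻¹ * deriv X τ) := by
  obtain ⟨c, hc, hmul⟩ := exists_isoNorm_mul_le (n := n) hμ hμc hκ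
  obtain ⟨X₀, hX₀, hX₀A, hX₀B⟩ := exists_isRectifiableCurve hA hB
  set L₀ := ∫ τ in (0 : ℝ)..1, isoNorm μ μc κ ((X₀ τ)⁻¹ * deriv X₀ τ) with hL₀
  have hL₀0 : 0 ≤ L₀ := intervalIntegral.integral_nonneg zero_le_one fun _ _ => isoNorm_nonneg _
  -- For `N ≥ N₀` the denominator `1 - c L₀ / N` is at least `1 / 2`, so one reference curve bounds
  -- the minimal energies uniformly in `N`.
  obtain ⟨N₀, hN₀⟩ := exists_nat_gt (2 * c * L₀)
  have hsmall : ∀ N : ℕ, N₀ ≤ N → 0 < N → c * (L₀ / N) ≤ 1 / 2 := by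
    intro N hN hN0
    have h1 : (0 : ℝ) < N := by exact_mod_cast hN0
    have h2 : (N₀ : ℝ) ≤ N := by exact_mod_cast hN
    rw [← mul_div_assoc, div_le_div_iff₀ h1 two_pos]
    linarith
  have hbase : ∀ N : ℕ, N₀ ≤ N → 0 < N → ∃ g : ℕ → Mat n, chain A g N = B ∧
      N * chainEnergy μ μc κ g N ≤ (L₀ / (1 / 2)) ^ 2 := by
    intro N hN hN0
    have h1 := hsmall N hN hN0
    obtain ⟨g, hg, hE⟩ := exists_chain_energy_le hμ hμc hκ hX₀ hc hmul hL₀.symm hN0 (by linarith)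
    refine ⟨g, by rw [← hX₀A, ← hX₀B, hg], hE.trans ?_⟩
    gcongr
    · exact div_nonneg hL₀0 (by linarith)
    · linarith
  have hmin : ∀ N : ℕ, ∃ g : ℕ → Mat n, N₀ ≤ N → 0 < N → chain A g N = B ∧
      ∀ h, chain A h N = B → chainEnergy μ μc κ g N ≤ chainEnergy μ μc κ h N := by
    intro N
    by_cases hN : N₀ ≤ N ∧ 0 < N
    · obtain ⟨g, hg, -⟩ := hbase N hN.1 hN.2
      obtain ⟨g', hg'⟩ := exists_minimal_chain hμ hμc hκ ⟨g, hg⟩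
      exact ⟨g', fun _ _ => hg'⟩
    · exact ⟨0, fun h1 h2 => absurd ⟨h1, h2⟩ hN⟩
  choose g hg using hmin
  have hEL : ∀ N : ℕ, N₀ ≤ N → 0 < N → ∀ i, i + 1 < N →
      (1 + g N i)ᵀ * isoOp μ μc κ (g N i)
        = isoOp μ μc κ (g N (i + 1)) * (1 + g N (i + 1))ᵀ := fun N h1 h2 i hi =>
    transpose_mul_isoOp_of_minimal hμ hμc hκ (hg N h1 h2).1 (hg N h1 h2).2 hi
  obtain ⟨R, hR⟩ := exists_step_bound hμ hμc hκ (A := A) hB.ne' ((L₀ / (1 / 2)) ^ 2)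
  have hbound : ∀ N : ℕ, N₀ ≤ N → 0 < N →
      (∀ i ≤ N, ‖chain A (g N) i‖ ≤ R) ∧ ∀ i < N, N * ‖g N i‖ ≤ R := by
    intro N h1 h2
    obtain ⟨g', hg', hE⟩ := hbase N h1 h2
    refine hR N (g N) (hg N h1 h2).1 (hEL N h1 h2) (le_trans ?_ hE)
    gcongr
    exact (hg N h1 h2).2 g' hg'
  set V : ℕ → ℕ → Mat n := fun N i => (N : ℝ) • g N i with hV
  set X : ℕ → ℕ → Mat n := fun N i => chain A (g N) i with hX
  have hmeshV : ∀ (p : ℕ × ℕ) (i : ℕ), 0 < p.1 → mesh p • V p.1 i = g p.1 i := by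
    intro p i hp
    have : (p.1 : ℝ) ≠ 0 := by exact_mod_cast hp.ne'
    rw [hV, mesh, smul_smul, inv_mul_cancel₀ this, one_smul]
  have hVO : (fun p : ℕ × ℕ => V p.1 p.2) =O[𝓟 (meshSet N₀ 1)] fun _ => (1 : ℝ) := by
    refine isBigO_principal.2 ⟨R, fun p hp => ?_⟩
    rw [norm_one, mul_one, hV, norm_smul, Real.norm_natCast]
    exact (hbound p.1 hp.1 hp.2.1).2 p.2 hp.2.2
  have hXO : (fun p : ℕ × ℕ => X p.1 p.2) =O[𝓟 (meshSet N₀ 0)] fun _ => (1 : ℝ) := by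
    refine isBigO_principal.2 ⟨R, fun p hp => ?_⟩
    rw [norm_one, mul_one]
    exact (hbound p.1 hp.1 hp.2.1).1 p.2 hp.2.2
  have hVEL : ∀ p ∈ meshSet N₀ 2, (1 + mesh p • V p.1 p.2)ᵀ * isoOp μ μc κ (V p.1 p.2)
      = isoOp μ μc κ (V p.1 (p.2 + 1)) * (1 + mesh p • V p.1 (p.2 + 1))ᵀ := by
    intro p hp
    rw [hmeshV p _ hp.2.1, hmeshV p _ hp.2.1, hV, map_smul, map_smul, mul_smul_comm,
      smul_mul_assoc, hEL p.1 hp.1 hp.2.1 p.2 hp.2.2]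
  have hXs : ∀ p ∈ meshSet N₀ 1, X p.1 (p.2 + 1) = X p.1 p.2 * (1 + mesh p • V p.1 p.2) := by
    intro p hp
    rw [hmeshV p _ hp.2.1]
    rfl
  set Z : Mat n → Mat n := fun v => (1 + μc / μ) • skewPart v with hZ
  obtain ⟨C₁, hC₁⟩ := isBigO_principal.1 (isBigO_position hμ hμc hκ hVO hVEL
    (Z := fun N => Z (V N 0)) (fun _ => rfl) hXO (fun _ => rfl) hXs)
  obtain ⟨C₂, hC₂⟩ := isBigO_principal.1 (isBigO_rotated_velocity hμ hμc hκ hVO hVEL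
    (Z := fun N => Z (V N 0)) (fun _ => rfl))
  obtain ⟨K, hK, hKn⟩ := exists_isoNorm_le_norm (n := n) hμ hμc hκ
  -- The shift by `N₀ + 1` makes every index positive and at least `N₀`. The limit `M` is fixed
  -- here, before any competitor is considered.
  have hball : ∀ k : ℕ, V (k + (N₀ + 1)) 0 ∈ Metric.closedBall (0 : Mat n) R := by
    intro k
    rw [mem_closedBall_zero_iff, hV, norm_smul, Real.norm_natCast]
    exact (hbound (k + (N₀ + 1)) (by omega) (by omega)).2 0 (by omega)
  obtain ⟨M, -, φ, hφ, hlim⟩ := (isCompact_closedBall (0 : Mat n) R).tendsto_subseq hball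
  set ν : ℕ → ℕ := fun k => φ k + (N₀ + 1) with hν
  have hνN : ∀ k, N₀ ≤ ν k := fun k => by simp only [hν]; omega
  have hν0 : ∀ k, 0 < ν k := fun k => by simp only [hν]; omega
  have hνtop : Tendsto ν atTop atTop := 
    tendsto_atTop_mono (fun k => Nat.le_add_right _ _) hφ.tendsto_atTop
  have hνinv : Tendsto (fun k => ((ν k : ℕ) : ℝ)⁻¹) atTop (nhds 0) :=
    tendsto_inv_atTop_zero.comp (tendsto_natCast_atTop_atTop.comp hνtop)
  replace hlim : Tendsto (fun k => V (ν k) 0) atTop (nhds M) := hlim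
  refine ⟨M, ?_, fun X' a b hX' hX'a hX'b => ?_⟩
  · set F : Mat n → Mat n := fun v => B * NormedSpace.exp (-Z v) * NormedSpace.exp (-(v - Z v))
      with hF
    have hZc : Continuous Z := (skewCLM (n := n)).continuous.const_smul (1 + μc / μ)
    have hexp : Continuous fun v : Mat n => NormedSpace.exp v :=
      NormedSpace.exp_continuous (𝔸 := Mat n)
    have hFc : Continuous F := (continuous_const.mul (hexp.comp hZc.neg)).mul
      (hexp.comp (continuous_id.sub hZc).neg)
    have hFle : ∀ k, ‖F (V (ν k) 0) - A‖ ≤ C₁ * ((ν k : ℕ) : ℝ)⁻¹ := by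
      intro k
      -- At the last node `i = N` the time is `1` and the position is `B`.
      have h1 := hC₁ (ν k, ν k) ⟨hνN k, hν0 k, le_rfl⟩
      have h2 : ((ν k : ℕ) : ℝ) * mesh (ν k, ν k) = 1 :=
        mul_inv_cancel₀ (by exact_mod_cast (hν0 k).ne')
      have h3 : X (ν k) (ν k) = B := (hg _ (hνN k) (hν0 k)).1
      rw [Real.norm_of_nonneg (mesh_nonneg _)] at h1
      simp only [h2, h3, one_smul] at h1
      exact h1
    have hFA : F M = A := by
      refine tendsto_nhds_unique ((hFc.tendsto M).comp hlim) ?_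
      refine tendsto_iff_norm_sub_tendsto_zero.2 (squeeze_zero (fun _ => norm_nonneg _) hFle ?_)
      simpa using hνinv.const_mul C₁
    have hMZ : symPart M - (μc / μ) • skewPart M = M - Z M := by
      have h1 : M - Z M = symPart M + skewPart M - Z M := by rw [symPart_add_skewPart]
      rw [h1, hZ]
      module
    change A * NormedSpace.exp (symPart M - (μc / μ) • skewPart M) * NormedSpace.exp (Z M) = B
    rw [hMZ, ← hFA]
    have h1 : NormedSpace.exp (-(M - Z M)) * NormedSpace.exp (M - Z M) = 1 := exp_neg_mul_exp _
    have h2 : NormedSpace.exp (-Z M) * NormedSpace.exp (Z M) = 1 := exp_neg_mul_exp _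
    calc B * NormedSpace.exp (-Z M) * NormedSpace.exp (-(M - Z M)) * NormedSpace.exp (M - Z M)
          * NormedSpace.exp (Z M)
        = B * NormedSpace.exp (-Z M) * (NormedSpace.exp (-(M - Z M)) * NormedSpace.exp (M - Z M))
          * NormedSpace.exp (Z M) := by simp only [mul_assoc]
      _ = B := by rw [h1, mul_one, mul_assoc, h2, mul_one]
  · set L := ∫ τ in a..b, isoNorm μ μc κ ((X' τ)⁻¹ * deriv X' τ) with hL
    have hL0 : 0 ≤ L := intervalIntegral.integral_nonneg hX'.le fun _ _ => isoNorm_nonneg _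
    have hdenom : Tendsto (fun k => c * (L / ((ν k : ℕ) : ℝ))) atTop (nhds 0) := by
      simpa [div_eq_mul_inv] using (hνinv.const_mul L).const_mul c
    have hrhs : Tendsto (fun k => L / (1 - c * (L / ((ν k : ℕ) : ℝ))) + K * (C₂ * ((ν k : ℕ) : ℝ)⁻¹))
        atTop (nhds L) := by
      have h1 := (tendsto_const_nhds (x := L)).div (tendsto_const_nhds.sub hdenom)
        (by norm_num : (1 : ℝ) - 0 ≠ 0)
      simpa using h1.add ((hνinv.const_mul C₂).const_mul K)
    refine le_of_tendsto_of_tendsto (((continuous_isoNorm hμ hμc hκ).tendsto M).comp hlim) hrhs ?_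
    filter_upwards [hdenom.eventually (gt_mem_nhds one_pos)] with k hk
    obtain ⟨g', hg', hE⟩ := exists_chain_energy_le hμ hμc hκ hX' hc hmul hL.symm (hν0 k) hk
    rw [hX'a, hX'b] at hg'
    obtain ⟨hgB, hgmin⟩ := hg _ (hνN k) (hν0 k)
    have hE' : (ν k : ℕ) * chainEnergy μ μc κ (g (ν k)) (ν k)
        ≤ (L / (1 - c * (L / ((ν k : ℕ) : ℝ)))) ^ 2 := by
      refine le_trans ?_ hE
      gcongr
      exact hgmin g' hg'
    obtain ⟨i, hi, hile⟩ := exists_isoNorm_le_of_energy_le (hν0 k)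
      (div_nonneg hL0 (by linarith)) hE'
    -- The short step `i`, rotated back, differs from the initial velocity by `O(1/N)`, which
    -- transfers its bound to index `0`.
    have h1 := hC₂ (ν k, i) ⟨hνN k, hν0 k, hi⟩
    rw [Real.norm_of_nonneg (mesh_nonneg _), norm_sub_rev] at h1
    set U := NormedSpace.exp ((i * mesh (ν k, i)) • Z (V (ν k) 0)) * V (ν k) i
      * NormedSpace.exp ((i * mesh (ν k, i)) • -Z (V (ν k) 0)) with hU
    have h2 : isoNorm μ μc κ U = (ν k : ℕ) * isoNorm μ μc κ (g (ν k) i) := by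
      rw [hU, hZ, isoNorm_rotated, hV, isoNorm_eq hμ hμc hκ, isoNorm_eq hμ hμc hκ, map_smul,
        norm_smul, Real.norm_natCast]
    calc isoNorm μ μc κ (V (ν k) 0) = isoNorm μ μc κ (U + (V (ν k) 0 - U)) := by
          rw [add_sub_cancel]
      _ ≤ isoNorm μ μc κ U + isoNorm μ μc κ (V (ν k) 0 - U) := isoNorm_add_le hμ hμc hκ _ _
      _ ≤ _ := by
        rw [h2]
        refine add_le_add hile ((hKn _).trans ?_)
        gcongr
        exact h1

end Existence

end GLGeod

/-! ### The geodesic distance as an attained minimum. -/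

theorem mainTheorem3 (n : ℕ) (hn : 0 < n) (μ μc κ : ℝ) (hμ : 0 < μ) (hμc : 0 < μc) (hκ : 0 < κ)
    (A B : Matrix (Fin n) (Fin n) ℝ) (hA : 0 < A.det) (hB : 0 < B.det) :
    (GLGeod.geodSolutions (μc / μ) A B).Nonempty ∧
    IsLeast ((fun M => ENNReal.ofReal (GLGeod.isoNorm μ μc κ M)) ''
        GLGeod.geodSolutions (μc / μ) A B)
      (GLGeod.geodDist (GLGeod.isoMetric μ μc κ) A B) := by
  have : NeZero n := ⟨hn.ne'⟩
  obtain ⟨M, hM, hle⟩ := GLGeod.exists_solution_le_length hμ hμc hκ hA hB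
  refine ⟨⟨M, hM⟩, ⟨M, hM, le_antisymm ?_ (GLGeod.geodDist_le_isoNorm hA.ne' hM)⟩, ?_⟩
  · refine le_sInf ?_
    rintro _ ⟨a, b, X, hX, rfl⟩
    exact ENNReal.ofReal_le_ofReal (hle X a b hX.isRectifiableCurve hX.source hX.target)
  · rintro _ ⟨M', hM', rfl⟩
    exact GLGeod.geodDist_le_isoNorm hA.ne' hM'
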